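/- Fix integers $d\ge 2$ and $0\le j<d-1$. The random $d$-process on $n$ labelled vertices starts with the empty graph $G_0$; at each step one edge is added, chosen uniformly at random from all pairs of distinct vertices that are not yet edges and both of whose vertices have current degree less than $d$; the process stops when there is no such pair. Let $G_s$ be the graph with $s$ edges in the process, for $s$ from $0$ up to the number of edges of the final graph; let $N=\lfloor dn/2\rfloor$, the maximum possible number of edges; and let $$S_j=\max\{s:\delta(G_s)\le j\},$$ where $\delta$ denotes the minimum degree. For real $t>0$ put $$f_j(d,t,n)=\frac{2\,[d-1]_{d-1-j}\;t}{\log^{d-1-j}n},\qquad [x]_k=x(x-1)\cdots(x-k+1),$$ where $\log$ is the natural logarithm. Then for every positive real $t=t(n)$ (constant or depending on $n$ in any way), as $n\to\infty$, $$\mathbb P(S_j<N-t)=e^{-\lambda}+o(1),\qquad \lambda=f_j(d,t,n).$$ Consequently $N-S_j$ is of order $\log^{d-1-j}n$ in probability: for every $\varepsilon>0$ there are constants $0<c\le C$ such that, for all sufficiently large $n$, $$\mathbb P\bigl(c\log^{d-1-j}n\le N-S_j\le C\log^{d-1-j}n\bigr)\ge 1-\varepsilon .$$ -/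

import Mathlib

open Filter Topology

/-- A (partial) run of an edge-adding process on the vertex set `{0, …, n-1}`: the list of the edges
in the order in which they were added. -/
abbrev EdgeHistory (n : ℕ) : Type := List (Sym2 (Fin n))

/-- The graph `G_s` of a run: its edges are the first `s` edges that were added. -/
def graphAt {n : ℕ} (h : EdgeHistory n) (s : ℕ) : SimpleGraph (Fin n) :=
  SimpleGraph.fromEdgeSet {e | e ∈ h.take s}

open Classical in
/-- The pairs that the `d`-process may add to `G` in the next step: the pairs of distinct vertices
which are not yet edges and whose two vertices both have degree less than `d`. -/
noncomputable def allowedPairs {n : ℕ} (d : ℕ) (G : SimpleGraph (Fin n)) :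
    Finset (Sym2 (Fin n)) :=
  {e | ¬ e.IsDiag ∧ e ∉ G.edgeSet ∧ ∀ v ∈ e, G.degree v < d}

open Classical in
/-- One step of the `d`-process: add a uniformly random allowed pair to the current graph; if there
is none, the process is stuck and the run stays as it is. -/
noncomputable def dStep {n : ℕ} (d : ℕ) (h : EdgeHistory n) : PMF (EdgeHistory n) :=
  if hne : (allowedPairs d (graphAt h h.length)).Nonempty then
    (PMF.uniformOfFinset _ hne).map (fun e => h ++ [e])
  else PMF.pure h

/-- The law of the run of the `d`-process on `n` vertices after `k` steps, from the empty graph. -/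
noncomputable def dRun (d n : ℕ) : ℕ → PMF (EdgeHistory n)
  | 0 => PMF.pure []
  | k + 1 => (dRun d n k).bind (dStep d)

/-- The law of the complete run of the `d`-process on `n` vertices. At most `N = ⌊dn/2⌋` edges can
ever be added, so the process is stuck after `N` steps. The length of the run is the number of edges
of the final graph. -/
noncomputable def dFullRun (d n : ℕ) : PMF (EdgeHistory n) := dRun d n (d * n / 2)

/-- The probability of an event in the `d`-process on `n` vertices. -/
noncomputable def dProb (d n : ℕ) (A : Set (EdgeHistory n)) : ℝ :=
  ((dFullRun d n).toOuterMeasure A).toReal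

open Classical in
/-- `S_j = max {s : δ(G_s) ≤ j}`, where `s` runs over the times `0, 1, …` up to the end of the run.
The set is bounded, and for `n ≥ 1` it contains `0`, so that the supremum is a maximum. -/
noncomputable def lastTime {n : ℕ} (j : ℕ) (h : EdgeHistory n) : ℕ :=
  sSup {s | s ≤ h.length ∧ (graphAt h s).minDegree ≤ j}

/-- `f_j(d,t,n) = 2 [d-1]_{d-1-j} t / log^{d-1-j} n`. -/
noncomputable def fRate (j d : ℕ) (t : ℝ) (n : ℕ) : ℝ :=
  2 * ((d - 1).descFactorial (d - 1 - j) : ℝ) * t / Real.log n ^ (d - 1 - j)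

/-! ### Averages over runs and the degree bookkeeping of the process -/

section
open Classical

variable {d n : ℕ}

/-! With `U` unsaturated vertices (degree less than `d`), the next edge contains a given one of them
with probability `2 / U + O(1 / U ^ 2)`, and two given ones with probability `O(1 / U ^ 2)`. Measure
time by the random `clock`, the sum of the `2 / U`. On this scale the degrees grow almost like
independent Poisson processes of rate 1, stopped at `d`.

To make this precise, fix a clock time `a` and give each vertex the weight `wt`, the Poisson
probability that its degree is at most `m` when the clock reaches `a`. The derivative of the Poisson
probabilities (`hasDerivAt_poi`) makes the advance of the clock cancel the expected effect of a new
edge. So the sum of the weights, their sum over ordered pairs, and the product of the `1 - wt` are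
martingales up to errors governed by `1 / U ^ 2` (`stepMean_sumW`, `stepMean_pairW`,
`stepMean_prodW`). Summed over the first `T` steps, the error factors are `O(1 / (d * n - 2 * T))`
(`sum_stepErr_le`), which vanishes for the relevant `T`.

Take `a = critTime j κ n`. In the Poisson model the expected number of vertices of degree at most
`j` tends to `κ / j!`, while about `κ / (d-1)! * log ^ (d-1-j) n` vertices are unsaturated, nearly
all of degree `d - 1`; so this is also the number of missing half-edges. A second-moment argument
with `m = d - 1` and a first-moment bound with `m = d - 2` show that the clock passes `a` when about
half as many edges are missing (`tendsto_runProb_clock_le`, `tendsto_runProb_lt_clock`).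

The product with `m = j` starts at `(1 - poi (j + 1) a) ^ n`, which tends to `exp (-κ / j!)`, and
when the clock reaches `a` it is nearly the indicator that no vertex of degree at most `j` remains.
Squeezing `κ` around `2 * c * (d-1)!` gives the limit law for `t = c * log ^ (d-1-j) n`
(`tendsto_runProb_lowCount`). Monotonicity in `t` and continuity of the limit extend it to arbitrary
`t` (`tendsto_sub_exp_of_antitone`). -/

/-- The mean of `f` after one step of the `d`-process from the run `h`. -/
noncomputable def stepMean (d : ℕ) (h : EdgeHistory n) (f : EdgeHistory n → ℝ) : ℝ :=
  if (allowedPairs d (graphAt h h.length)).Nonempty then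
    (∑ e ∈ allowedPairs d (graphAt h h.length), f (h ++ [e])) /
      ((allowedPairs d (graphAt h h.length)).card : ℝ)
  else f h

/-- The mean of `f` after `k` steps of the `d`-process. -/
noncomputable def runMean (d n : ℕ) : ℕ → (EdgeHistory n → ℝ) → ℝ
  | 0, f => f []
  | k + 1, f => runMean d n k (fun h => stepMean d h f)

theorem tsum_pure_mul {α : Type*} (x : α) (F : α → ENNReal) :
    ∑' b, (PMF.pure x) b * F b = F x := by
  rw [tsum_eq_single x]
  · simp
  · intro b hb
    simp [PMF.pure_apply, hb]

theorem tsum_bind_mul {α β : Type*} (p : PMF α) (q : α → PMF β) (F : β → ENNReal) :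
    ∑' b, (p.bind q) b * F b = ∑' a, p a * ∑' b, q a b * F b := by
  simp_rw [PMF.bind_apply, ← ENNReal.tsum_mul_right, ← ENNReal.tsum_mul_left]
  rw [ENNReal.tsum_comm]
  simp_rw [mul_assoc]

theorem stepMean_nonneg (h : EdgeHistory n) {f : EdgeHistory n → ℝ} (hf : ∀ h, 0 ≤ f h) :
    0 ≤ stepMean d h f := by
  unfold stepMean
  split_ifs
  · exact div_nonneg (Finset.sum_nonneg fun _ _ => hf _) (Nat.cast_nonneg _)
  · exact hf h

theorem tsum_dStep (h : EdgeHistory n) {f : EdgeHistory n → ℝ} (hf : ∀ h, 0 ≤ f h) :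
    ∑' b, dStep d h b * ENNReal.ofReal (f b) = ENNReal.ofReal (stepMean d h f) := by
  unfold dStep stepMean
  split_ifs with hne
  · rw [PMF.map, tsum_bind_mul]
    simp only [Function.comp, tsum_pure_mul]
    rw [tsum_eq_sum (s := allowedPairs d (graphAt h h.length))]
    · rw [ENNReal.ofReal_div_of_pos (by exact_mod_cast hne.card_pos),
        ENNReal.ofReal_sum_of_nonneg (fun _ _ => hf _), ENNReal.ofReal_natCast, div_eq_mul_inv,
        Finset.sum_mul]
      refine Finset.sum_congr rfl fun e he => ?_
      rw [PMF.uniformOfFinset_apply_of_mem _ he, mul_comm]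
    · intro e he
      rw [PMF.uniformOfFinset_apply_of_notMem _ he, zero_mul]
  · exact tsum_pure_mul _ _

theorem tsum_dRun (k : ℕ) : ∀ {f : EdgeHistory n → ℝ}, (∀ h, 0 ≤ f h) →
    ∑' b, dRun d n k b * ENNReal.ofReal (f b) = ENNReal.ofReal (runMean d n k f) := by
  induction k with
  | zero => intro f _; exact tsum_pure_mul _ _
  | succ k ih =>
    intro f hf
    rw [dRun, tsum_bind_mul, runMean, ← ih (fun h => stepMean_nonneg h hf)]
    simp_rw [tsum_dStep _ hf]

theorem runMean_nonneg (k : ℕ) : ∀ {f : EdgeHistory n → ℝ}, (∀ h, 0 ≤ f h) →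
    0 ≤ runMean d n k f := by
  induction k with
  | zero => intro f hf; exact hf []
  | succ k ih => intro f hf; exact ih (fun h => stepMean_nonneg h hf)

/-- Replaces the measure by iterated finite averages, which are manipulated one step at a time from
here on. -/
theorem dProb_eq_runMean (A : Set (EdgeHistory n)) :
    dProb d n A = runMean d n (d * n / 2) (A.indicator 1) := by
  have h0 : ∀ h, 0 ≤ A.indicator (1 : EdgeHistory n → ℝ) h := fun h =>
    Set.indicator_nonneg (fun _ _ => zero_le_one) h
  have key := tsum_dRun (d := d) (n := n) (d * n / 2) h0
  rw [dProb, PMF.toOuterMeasure_apply, dFullRun]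
  have : ∀ x, A.indicator (dRun d n (d * n / 2)) x =
      dRun d n (d * n / 2) x * ENNReal.ofReal (A.indicator (1 : EdgeHistory n → ℝ) x) := by
    intro x
    by_cases hx : x ∈ A <;> simp [hx]
  simp_rw [this]
  rw [key, ENNReal.toReal_ofReal (runMean_nonneg _ h0)]

/-! ### Reachable runs: degrees, unsaturated vertices and allowed pairs -/

/-- The runs that the `d`-process can produce. -/
inductive Reach (d : ℕ) : EdgeHistory n → Prop
  | nil : Reach d []
  | snoc (h : EdgeHistory n) (e : Sym2 (Fin n)) : Reach d h →
      e ∈ allowedPairs d (graphAt h h.length) → Reach d (h ++ [e])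

/-- The degree of `v` in the final graph of the run `h`. -/
noncomputable def hdeg (h : EdgeHistory n) (v : Fin n) : ℕ := h.countP (fun e => v ∈ e)

@[simp] theorem hdeg_nil (v : Fin n) : hdeg [] v = 0 := rfl

theorem hdeg_snoc (h : EdgeHistory n) (e : Sym2 (Fin n)) (v : Fin n) :
    hdeg (h ++ [e]) v = hdeg h v + if v ∈ e then 1 else 0 := by
  simp [hdeg, List.countP_append, List.countP_cons]

theorem mem_edgeSet_graphAt {h : EdgeHistory n} (hd : ∀ e ∈ h, ¬ e.IsDiag) {s : ℕ}
    {e : Sym2 (Fin n)} : e ∈ (graphAt h s).edgeSet ↔ e ∈ h.take s := by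
  rw [graphAt, SimpleGraph.edgeSet_fromEdgeSet]
  constructor
  · exact fun he => he.1
  · exact fun he => ⟨he, hd e (List.mem_of_mem_take he)⟩

theorem degree_graphAt {h : EdgeHistory n} (hn : h.Nodup) (hd : ∀ e ∈ h, ¬ e.IsDiag) (s : ℕ)
    (v : Fin n) [Fintype ((graphAt h s).neighborSet v)] :
    (graphAt h s).degree v = hdeg (h.take s) v := by
  have h1 : (graphAt h s).degree v = ((graphAt h s).incidenceFinset v).card :=
    ((graphAt h s).card_incidenceFinset_eq_degree v).symm
  rw [h1, hdeg, List.countP_eq_length_filter,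
    ← List.toFinset_card_of_nodup ((hn.sublist (List.take_sublist s h)).filter _)]
  congr 1
  ext e
  simp only [SimpleGraph.mem_incidenceFinset, List.mem_toFinset, List.mem_filter, decide_eq_true_eq]
  rw [SimpleGraph.incidenceSet, Set.mem_ofPred_eq, mem_edgeSet_graphAt hd]

theorem mem_allowedPairs {h : EdgeHistory n} (hn : h.Nodup) (hd : ∀ e ∈ h, ¬ e.IsDiag)
    {e : Sym2 (Fin n)} : e ∈ allowedPairs d (graphAt h h.length) ↔
      ¬ e.IsDiag ∧ e ∉ h ∧ ∀ v ∈ e, hdeg h v < d := by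
  simp only [allowedPairs, Finset.mem_filter, Finset.mem_univ, true_and,
    mem_edgeSet_graphAt hd, degree_graphAt hn hd, List.take_length]

theorem Reach.wf {h : EdgeHistory n} (hr : Reach d h) :
    h.Nodup ∧ (∀ e ∈ h, ¬ e.IsDiag) ∧ ∀ v, hdeg h v ≤ d := by
  induction hr with
  | nil => simp
  | snoc h e _ he ih =>
    obtain ⟨h1, h2, h3⟩ := ih
    rw [mem_allowedPairs h1 h2] at he
    refine ⟨?_, ?_, ?_⟩
    · rw [← List.concat_eq_append]
      exact h1.concat he.2.1
    · intro e' he'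
      rw [List.mem_append, List.mem_singleton] at he'
      rcases he' with he' | rfl
      · exact h2 _ he'
      · exact he.1
    · intro v
      rw [hdeg_snoc]
      split_ifs with hv
      · exact he.2.2 v hv
      · exact h3 v

theorem Reach.mem_allowed {h : EdgeHistory n} (hr : Reach d h) {e : Sym2 (Fin n)} :
    e ∈ allowedPairs d (graphAt h h.length) ↔ ¬ e.IsDiag ∧ e ∉ h ∧ ∀ v ∈ e, hdeg h v < d :=
  mem_allowedPairs hr.wf.1 hr.wf.2.1

/-- The vertices of degree less than `d`. -/
noncomputable def unsat (d : ℕ) (h : EdgeHistory n) : Finset (Fin n) := {v | hdeg h v < d}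

theorem mem_unsat {h : EdgeHistory n} {v : Fin n} : v ∈ unsat d h ↔ hdeg h v < d := by
  simp [unsat]

theorem card_filter_mem_sym2 {e : Sym2 (Fin n)} (he : ¬ e.IsDiag) :
    ({v | v ∈ e} : Finset (Fin n)).card = 2 := by
  induction e with
  | _ a b =>
    have hab : a ≠ b := by simpa using he
    rw [← Finset.card_pair hab]
    congr 1
    ext v
    simp

theorem Reach.sum_hdeg {h : EdgeHistory n} (hr : Reach d h) : ∑ v, hdeg h v = 2 * h.length := by
  induction hr with
  | nil => simp
  | snoc h e hr he ih =>
    simp_rw [hdeg_snoc]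
    rw [Finset.sum_add_distrib, ih, ← Finset.card_filter,
      card_filter_mem_sym2 (hr.mem_allowed.1 he).1]
    simp [mul_add]

/-- Counts the missing half-edges. The next three bounds come from the deficit of an unsaturated
vertex lying between 1 and `d`, and being exactly 1 unless the degree is at most `d - 2`. -/
theorem Reach.sum_deficit {h : EdgeHistory n} (hr : Reach d h) :
    ∑ v ∈ unsat d h, (d - hdeg h v) + 2 * h.length = d * n := by
  have h1 : ∑ v ∈ unsat d h, (d - hdeg h v) = ∑ v, (d - hdeg h v) := by
    apply Finset.sum_subset (Finset.subset_univ _)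
    intro v _ hv
    rw [mem_unsat, not_lt] at hv
    omega
  rw [h1, ← hr.sum_hdeg, ← Finset.sum_add_distrib]
  rw [Finset.sum_congr rfl (fun v _ => Nat.sub_add_cancel (hr.wf.2.2 v))]
  simp [mul_comm]

theorem Reach.le_card_unsat {h : EdgeHistory n} (hr : Reach d h) :
    d * n ≤ d * (unsat d h).card + 2 * h.length := by
  rw [← hr.sum_deficit]
  gcongr
  rw [mul_comm, ← smul_eq_mul]
  exact Finset.sum_le_card_nsmul _ _ _ (fun v _ => Nat.sub_le _ _)

theorem Reach.card_unsat_le {h : EdgeHistory n} (hr : Reach d h) :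
    (unsat d h).card + 2 * h.length ≤ d * n := by
  rw [← hr.sum_deficit]
  gcongr
  rw [Finset.card_eq_sum_ones]
  apply Finset.sum_le_sum
  intro v hv
  rw [mem_unsat] at hv
  omega

theorem Reach.le_card_unsat_add {h : EdgeHistory n} (hr : Reach d h) :
    d * n ≤ (unsat d h).card + d * ({v | hdeg h v + 2 ≤ d} : Finset (Fin n)).card
      + 2 * h.length := by
  rw [← hr.sum_deficit]
  gcongr
  have : ∀ v ∈ unsat d h, d - hdeg h v ≤ 1 + if hdeg h v + 2 ≤ d then d else 0 := by
    intro v hv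
    split_ifs <;> omega
  refine (Finset.sum_le_sum this).trans ?_
  rw [Finset.sum_add_distrib, ← Finset.card_eq_sum_ones]
  gcongr
  rw [← Finset.sum_filter, Finset.sum_const, smul_eq_mul, mul_comm]
  gcongr
  exact Finset.subset_univ _

/-- The allowed pairs that contain `v`. -/
theorem Reach.card_allowed_mem {h : EdgeHistory n} (hr : Reach d h) {v : Fin n}
    (hv : v ∈ unsat d h) :
    (unsat d h).card ≤ ((allowedPairs d (graphAt h h.length)).filter (v ∈ ·)).card + d ∧
    ((allowedPairs d (graphAt h h.length)).filter (v ∈ ·)).card + 1 ≤ (unsat d h).card := by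
  -- The partners excluded for `v` are `v` itself and its neighbours, of which there are at most `d
  -- - 1` as `v` is unsaturated.
  set B : Finset (Fin n) := {w | s(v, w) ∈ h} with hB
  have hBc : B.card ≤ hdeg h v := by
    have h1 : B.image (fun w => s(v, w)) ⊆ (h.filter (fun e => v ∈ e)).toFinset := by
      intro e he
      rw [Finset.mem_image] at he
      obtain ⟨w, hw, rfl⟩ := he
      simp only [hB, Finset.mem_filter, Finset.mem_univ, true_and] at hw
      simp [hw]
    have h2 := Finset.card_le_card h1
    rw [Finset.card_image_of_injective _ (fun a b hab => Sym2.congr_right.1 hab)] at h2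
    refine h2.trans ((List.toFinset_card_le _).trans ?_)
    rw [hdeg, List.countP_eq_length_filter]
  have hE : (allowedPairs d (graphAt h h.length)).filter (v ∈ ·) =
      (((unsat d h).erase v) \ B).image (fun w => s(v, w)) := by
    ext e
    simp only [Finset.mem_filter, Finset.mem_image, Finset.mem_sdiff, Finset.mem_erase,
      hr.mem_allowed, hB, Finset.mem_univ, true_and]
    constructor
    · rintro ⟨⟨h1, h2, h3⟩, h4⟩
      obtain ⟨w, rfl⟩ := h4
      refine ⟨w, ⟨⟨?_, mem_unsat.2 (h3 w (by simp))⟩, h2⟩, rfl⟩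
      rintro rfl
      simp at h1
    · rintro ⟨w, ⟨⟨h1, h2⟩, h3⟩, rfl⟩
      refine ⟨⟨?_, h3, ?_⟩, by simp⟩
      · simpa using h1.symm
      · intro x hx
        rw [Sym2.mem_iff] at hx
        rcases hx with rfl | rfl
        · exact mem_unsat.1 hv
        · exact mem_unsat.1 h2
  rw [hE, Finset.card_image_of_injective _ (fun a b hab => Sym2.congr_right.1 hab)]
  have h1 := Finset.card_erase_of_mem hv
  have h2 := Finset.le_card_sdiff B ((unsat d h).erase v)
  have h3 := Finset.card_le_card (Finset.sdiff_subset (s := (unsat d h).erase v) (t := B))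
  have h4 := mem_unsat.1 hv
  have h5 : 0 < (unsat d h).card := Finset.card_pos.2 ⟨v, hv⟩
  omega

theorem Reach.sum_card_allowed {h : EdgeHistory n} (hr : Reach d h) :
    ∑ v ∈ unsat d h, ((allowedPairs d (graphAt h h.length)).filter (v ∈ ·)).card =
      2 * (allowedPairs d (graphAt h h.length)).card := by
  simp_rw [Finset.card_filter]
  rw [Finset.sum_comm, Finset.sum_const_nat (m := 2), mul_comm]
  intro e he
  rw [hr.mem_allowed] at he
  rw [← Finset.card_filter, ← card_filter_mem_sym2 he.1]
  congr 1
  ext v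
  simp only [Finset.mem_filter, Finset.mem_univ, true_and, mem_unsat]
  exact ⟨fun hx => hx.2, fun hx => ⟨he.2.2 v hx, hx⟩⟩

end

/-! ### Monotonicity of averages and the probabilities of the next edge -/

section
open Classical

variable {d n : ℕ}

/-- More than `2 * d * d` half-edges are missing and each vertex lacks at most `d`. The margin
ensures that the process is not stuck and that `U - d` is at least `U / 2`. -/
theorem Reach.two_mul_le_card {h : EdgeHistory n} (hr : Reach d h)
    (hl : 2 * d * d + 2 * h.length < d * n) : 2 * d < (unsat d h).card := by
  have h1 := hr.le_card_unsat
  by_contra! h2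
  have := Nat.mul_le_mul_left d h2
  nlinarith

theorem Reach.allowed_nonempty {h : EdgeHistory n} (hr : Reach d h)
    (hl : 2 * d * d + 2 * h.length < d * n) :
    (allowedPairs d (graphAt h h.length)).Nonempty := by
  have h1 := hr.two_mul_le_card hl
  have h2 : 0 < (unsat d h).card := by omega
  obtain ⟨v, hv⟩ := Finset.card_pos.1 h2
  have h3 := (hr.card_allowed_mem hv).1
  have h4 : 0 < ((allowedPairs d (graphAt h h.length)).filter (v ∈ ·)).card := by omega
  obtain ⟨e, he⟩ := Finset.card_pos.1 h4
  exact ⟨e, (Finset.mem_filter.1 he).1⟩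

theorem stepMean_mono {h : EdgeHistory n} {f g : EdgeHistory n → ℝ}
    (h1 : ∀ e ∈ allowedPairs d (graphAt h h.length), f (h ++ [e]) ≤ g (h ++ [e]))
    (h2 : f h ≤ g h) : stepMean d h f ≤ stepMean d h g := by
  unfold stepMean
  split_ifs
  · gcongr with e he
    exact h1 e he
  · exact h2

theorem stepMean_mono_of_nonempty {h : EdgeHistory n} {f g : EdgeHistory n → ℝ}
    (hne : (allowedPairs d (graphAt h h.length)).Nonempty)
    (h1 : ∀ e ∈ allowedPairs d (graphAt h h.length), f (h ++ [e]) ≤ g (h ++ [e])) :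
    stepMean d h f ≤ stepMean d h g := by
  unfold stepMean
  rw [if_pos hne, if_pos hne]
  gcongr with e he
  exact h1 e he

/-- The process cannot be stuck during the first `k` steps, so only reachable runs of length exactly
`k` contribute. -/
theorem runMean_mono (k : ℕ) (hk : 2 * d * d + 2 * k ≤ d * n) {f g : EdgeHistory n → ℝ}
    (hfg : ∀ h, Reach d h → h.length = k → f h ≤ g h) :
    runMean d n k f ≤ runMean d n k g := by
  induction k generalizing f g with
  | zero => exact hfg _ Reach.nil rfl
  | succ k ih =>
    refine ih (by omega) fun h hr hl => ?_
    refine stepMean_mono_of_nonempty (hr.allowed_nonempty (by omega)) fun e he => ?_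
    exact hfg _ (Reach.snoc h e hr he) (by simp [hl])

/-- Past `T` the process may be stuck, so the comparison is required for every reachable run of
length at least `T`, whatever its final length. -/
theorem runMean_mono_of_le {T : ℕ} (hT : 2 * d * d + 2 * T ≤ d * n) (k : ℕ) (hk : T ≤ k)
    {f g : EdgeHistory n → ℝ} (hfg : ∀ h, Reach d h → T ≤ h.length → f h ≤ g h) :
    runMean d n k f ≤ runMean d n k g := by
  induction k, hk using Nat.le_induction generalizing f g with
  | base => exact runMean_mono T hT fun h hr hl => hfg h hr hl.ge
  | succ k _ ih =>
    refine ih fun h hr hl => ?_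
    refine stepMean_mono (fun e he => ?_) (hfg h hr hl)
    refine hfg _ (Reach.snoc h e hr he) ?_
    rw [List.length_append]
    omega

theorem stepMean_add (h : EdgeHistory n) (f g : EdgeHistory n → ℝ) :
    stepMean d h (fun x => f x + g x) = stepMean d h f + stepMean d h g := by
  unfold stepMean
  split_ifs
  · rw [Finset.sum_add_distrib, add_div]
  · rfl

theorem stepMean_smul (h : EdgeHistory n) (c : ℝ) (f : EdgeHistory n → ℝ) :
    stepMean d h (fun x => c * f x) = c * stepMean d h f := by
  unfold stepMean
  split_ifs
  · rw [← Finset.mul_sum, mul_div_assoc]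
  · rfl

theorem stepMean_const (h : EdgeHistory n) (c : ℝ) : stepMean d h (fun _ => c) = c := by
  unfold stepMean
  split_ifs with hne
  · have : ((allowedPairs d (graphAt h h.length)).card : ℝ) ≠ 0 := by
      exact_mod_cast hne.card_pos.ne'
    rw [Finset.sum_const, nsmul_eq_mul, mul_div_cancel_left₀ _ this]
  · rfl

theorem runMean_add (k : ℕ) : ∀ f g : EdgeHistory n → ℝ,
    runMean d n k (fun x => f x + g x) = runMean d n k f + runMean d n k g := by
  induction k with
  | zero => intro f g; rfl
  | succ k ih =>
    intro f g
    simp only [runMean, stepMean_add, ih]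

theorem runMean_smul (k : ℕ) (c : ℝ) : ∀ f : EdgeHistory n → ℝ,
    runMean d n k (fun x => c * f x) = c * runMean d n k f := by
  induction k with
  | zero => intro f; rfl
  | succ k ih =>
    intro f
    simp only [runMean, stepMean_smul, ih]

theorem runMean_const (k : ℕ) (c : ℝ) : runMean d n k (fun _ => c) = c := by
  induction k with
  | zero => rfl
  | succ k ih => simp only [runMean, stepMean_const, ih]

/-- A one-step inequality with an error term adds up along the run. -/
theorem runMean_le_of_step {T : ℕ} (hT : 2 * d * d + 2 * T ≤ d * n) {f g : EdgeHistory n → ℝ}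
    {ε : ℕ → ℝ} (hstep : ∀ h, Reach d h → h.length < T →
      stepMean d h f ≤ f h + ε h.length * g h) (k : ℕ) (hk : k ≤ T) :
    runMean d n k f ≤ f [] + ∑ i ∈ Finset.range k, ε i * runMean d n i g := by
  induction k with
  | zero => simp [runMean]
  | succ k ih =>
    rw [Finset.sum_range_succ, ← add_assoc, runMean]
    have h1 : runMean d n k (fun h => stepMean d h f) ≤
        runMean d n k (fun h => f h + ε k * g h) := by
      refine runMean_mono k (by omega) fun h hr hl => ?_
      have := hstep h hr (by omega)
      rwa [hl] at this
    rw [runMean_add, runMean_smul] at h1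
    linarith [ih (by omega)]

/-- A one-step inequality with a relative error multiplies up along the run. -/
theorem runMean_le_exp_mul {T : ℕ} (hT : 2 * d * d + 2 * T ≤ d * n) {f : EdgeHistory n → ℝ}
    {ε : ℕ → ℝ} (hf : ∀ h, 0 ≤ f h) (hstep : ∀ h, Reach d h → h.length < T →
      stepMean d h f ≤ f h + ε h.length * f h) (k : ℕ) (hk : k ≤ T) :
    runMean d n k f ≤ Real.exp (∑ i ∈ Finset.range k, ε i) * f [] := by
  induction k with
  | zero => simp [runMean]
  | succ k ih =>
    rw [Finset.sum_range_succ, runMean, add_comm, Real.exp_add, mul_assoc]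
    have h1 : runMean d n k (fun h => stepMean d h f) ≤
        runMean d n k (fun h => Real.exp (ε k) * f h) := by
      refine runMean_mono k (by omega) fun h hr hl => ?_
      have h2 := hstep h hr (by omega)
      rw [hl] at h2
      have h3 := mul_le_mul_of_nonneg_right (Real.add_one_le_exp (ε k)) (hf h)
      linarith
    rw [runMean_smul] at h1
    exact h1.trans (mul_le_mul_of_nonneg_left (ih (by omega)) (Real.exp_pos _).le)

/-- The probability that the next edge satisfies `p`. -/
noncomputable def stepProb (d : ℕ) (h : EdgeHistory n) (p : Sym2 (Fin n) → Prop) : ℝ :=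
  (((allowedPairs d (graphAt h h.length)).filter p).card : ℝ) /
    ((allowedPairs d (graphAt h h.length)).card : ℝ)

theorem stepProb_nonneg (h : EdgeHistory n) (p : Sym2 (Fin n) → Prop) : 0 ≤ stepProb d h p := by
  unfold stepProb
  positivity

theorem Reach.card_allowed_bounds {h : EdgeHistory n} (hr : Reach d h) :
    ((unsat d h).card : ℝ) * ((unsat d h).card - d) ≤
      2 * ((allowedPairs d (graphAt h h.length)).card : ℝ) ∧
    2 * ((allowedPairs d (graphAt h h.length)).card : ℝ) ≤
      ((unsat d h).card : ℝ) * ((unsat d h).card - 1) := by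
  have h1 : (2 * (allowedPairs d (graphAt h h.length)).card : ℝ) =
      ∑ v ∈ unsat d h, (((allowedPairs d (graphAt h h.length)).filter (v ∈ ·)).card : ℝ) := by
    exact_mod_cast hr.sum_card_allowed.symm
  rw [h1]
  constructor
  · rw [← nsmul_eq_mul]
    refine Finset.card_nsmul_le_sum _ _ _ fun v hv => ?_
    have := (hr.card_allowed_mem hv).1
    rw [sub_le_iff_le_add]
    exact_mod_cast this
  · rw [← nsmul_eq_mul]
    refine Finset.sum_le_card_nsmul _ _ _ fun v hv => ?_
    have := (hr.card_allowed_mem hv).2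
    rw [le_sub_iff_add_le]
    exact_mod_cast this

theorem Reach.abs_stepProb_sub_le {h : EdgeHistory n} (hr : Reach d h)
    (hl : 2 * d * d + 2 * h.length < d * n) {v : Fin n} (hv : v ∈ unsat d h) :
    |stepProb d h (v ∈ ·) - 2 / (unsat d h).card| ≤ 4 * d / ((unsat d h).card : ℝ) ^ 2 := by
  obtain ⟨h1, h2⟩ := hr.card_allowed_bounds
  have hU : (2 * d + 1 : ℝ) ≤ (unsat d h).card := by exact_mod_cast hr.two_mul_le_card hl
  obtain ⟨h3, h4⟩ := hr.card_allowed_mem hv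
  have hd : (1 : ℝ) ≤ d := by
    have := mem_unsat.1 hv
    exact_mod_cast (by omega : 1 ≤ d)
  have h3' : ((unsat d h).card : ℝ) ≤
    ((allowedPairs d (graphAt h h.length)).filter (v ∈ ·)).card + d := by exact_mod_cast h3
  have h4' : (((allowedPairs d (graphAt h h.length)).filter (v ∈ ·)).card : ℝ) + 1 ≤
    (unsat d h).card := by exact_mod_cast h4
  have hM : (0 : ℝ) < (allowedPairs d (graphAt h h.length)).card := by
    exact_mod_cast (hr.allowed_nonempty hl).card_pos
  have hs : stepProb d h (v ∈ ·) =
      (((allowedPairs d (graphAt h h.length)).filter (v ∈ ·)).card : ℝ) /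
        ((allowedPairs d (graphAt h h.length)).card : ℝ) := by
    unfold stepProb
    congr!
  rw [hs]
  set U : ℝ := ((unsat d h).card : ℝ)
  set M : ℝ := ((allowedPairs d (graphAt h h.length)).card : ℝ)
  set c : ℝ := (((allowedPairs d (graphAt h h.length)).filter (v ∈ ·)).card : ℝ)
  have hU0 : 0 < U := by linarith
  -- Both `c * U` and `2 * M` lie between `U * (U - d)` and `U * (U - 1)`.
  have hkey : |c * U - 2 * M| ≤ U * (d - 1) := by
    rw [abs_le]
    constructor <;> nlinarith
  have : c / M - 2 / U = (c * U - 2 * M) / (M * U) := by field_simp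
  rw [this, abs_div, abs_of_pos (mul_pos hM hU0), div_le_div_iff₀ (by positivity) (by positivity)]
  have h5 : U * U ≤ 4 * M := by nlinarith
  calc |c * U - 2 * M| * U ^ 2 ≤ (U * (d - 1)) * U ^ 2 := by gcongr
    _ ≤ (U * d) * (U * U) := by
      rw [pow_two]
      gcongr
      linarith
    _ ≤ (U * d) * (4 * M) := by gcongr
    _ = _ := by ring

theorem Reach.stepProb_pair_le {h : EdgeHistory n} (hr : Reach d h)
    (hl : 2 * d * d + 2 * h.length < d * n) {u v : Fin n} (huv : u ≠ v) :
    stepProb d h (fun e => u ∈ e ∧ v ∈ e) ≤ 4 / ((unsat d h).card : ℝ) ^ 2 := by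
  obtain ⟨h1, -⟩ := hr.card_allowed_bounds
  have hU : (2 * d + 1 : ℝ) ≤ (unsat d h).card := by exact_mod_cast hr.two_mul_le_card hl
  have hM : (0 : ℝ) < (allowedPairs d (graphAt h h.length)).card := by
    exact_mod_cast (hr.allowed_nonempty hl).card_pos
  have hc : (((allowedPairs d (graphAt h h.length)).filter
      (fun e => u ∈ e ∧ v ∈ e)).card : ℝ) ≤ 1 := by
    have : (allowedPairs d (graphAt h h.length)).filter (fun e => u ∈ e ∧ v ∈ e) ⊆ {s(u, v)} := by
      intro e he
      rw [Finset.mem_filter] at he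
      rw [Finset.mem_singleton]
      exact (Sym2.mem_and_mem_iff huv).1 he.2
    exact_mod_cast (Finset.card_le_card this).trans (Finset.card_singleton _).le
  refine le_trans (b := 1 / ((allowedPairs d (graphAt h h.length)).card : ℝ)) ?_ ?_
  · rw [stepProb]
    refine div_le_div_of_nonneg_right (le_trans (le_of_eq ?_) hc) hM.le
    congr!
  set U : ℝ := ((unsat d h).card : ℝ)
  set M : ℝ := ((allowedPairs d (graphAt h h.length)).card : ℝ)
  have hd : (0 : ℝ) ≤ d := Nat.cast_nonneg d
  have hU0 : 0 < U := by linarith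
  rw [div_le_div_iff₀ hM (by positivity)]
  nlinarith

/-- The mean of `g` over the next edge. -/
noncomputable def edgeMean (d : ℕ) (h : EdgeHistory n) (g : Sym2 (Fin n) → ℝ) : ℝ :=
  (∑ e ∈ allowedPairs d (graphAt h h.length), g e) /
    ((allowedPairs d (graphAt h h.length)).card : ℝ)

theorem stepMean_eq_edgeMean {h : EdgeHistory n}
    (hne : (allowedPairs d (graphAt h h.length)).Nonempty) {f : EdgeHistory n → ℝ}
    {g : Sym2 (Fin n) → ℝ} (hfg : ∀ e, f (h ++ [e]) = g e) :
    stepMean d h f = edgeMean d h g := by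
  unfold stepMean edgeMean
  rw [if_pos hne]
  simp_rw [hfg]

theorem edgeMean_add (h : EdgeHistory n) (f g : Sym2 (Fin n) → ℝ) :
    edgeMean d h (fun x => f x + g x) = edgeMean d h f + edgeMean d h g := by
  unfold edgeMean
  rw [Finset.sum_add_distrib, add_div]

theorem edgeMean_sub (h : EdgeHistory n) (f g : Sym2 (Fin n) → ℝ) :
    edgeMean d h (fun x => f x - g x) = edgeMean d h f - edgeMean d h g := by
  unfold edgeMean
  rw [Finset.sum_sub_distrib, sub_div]

theorem edgeMean_mul_left (h : EdgeHistory n) (c : ℝ) (f : Sym2 (Fin n) → ℝ) :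
    edgeMean d h (fun x => c * f x) = c * edgeMean d h f := by
  unfold edgeMean
  rw [← Finset.mul_sum, mul_div_assoc]

theorem edgeMean_sum {ι : Type*} (s : Finset ι) (h : EdgeHistory n)
    (f : ι → Sym2 (Fin n) → ℝ) :
    edgeMean d h (fun x => ∑ i ∈ s, f i x) = ∑ i ∈ s, edgeMean d h (f i) := by
  unfold edgeMean
  rw [Finset.sum_comm, Finset.sum_div]

theorem edgeMean_const {h : EdgeHistory n}
    (hne : (allowedPairs d (graphAt h h.length)).Nonempty) (c : ℝ) :
    edgeMean d h (fun _ => c) = c := by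
  have : ((allowedPairs d (graphAt h h.length)).card : ℝ) ≠ 0 := by
    exact_mod_cast hne.card_pos.ne'
  rw [edgeMean, Finset.sum_const, nsmul_eq_mul, mul_div_cancel_left₀ _ this]

theorem edgeMean_indicator (h : EdgeHistory n) (p : Sym2 (Fin n) → Prop) [DecidablePred p] :
    edgeMean d h (fun e => if p e then 1 else 0) = stepProb d h p := by
  rw [edgeMean, stepProb, Finset.sum_boole]
  congr!

theorem edgeMean_mono (h : EdgeHistory n) {f g : Sym2 (Fin n) → ℝ} (hfg : ∀ e, f e ≤ g e) :
    edgeMean d h f ≤ edgeMean d h g := by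
  unfold edgeMean
  gcongr with e
  exact hfg e

theorem abs_edgeMean_le (h : EdgeHistory n) (f : Sym2 (Fin n) → ℝ) :
    |edgeMean d h f| ≤ edgeMean d h (fun e => |f e|) := by
  unfold edgeMean
  rw [abs_div, Nat.abs_cast]
  gcongr
  exact Finset.abs_sum_le_sum_abs _ _

end

/-! ### Poisson tail probabilities and their Taylor expansion -/

section

/-- The probability that a Poisson variable with mean `x` is less than `l`. -/
noncomputable def poi (l : ℕ) (x : ℝ) : ℝ :=
  Real.exp (-x) * ∑ i ∈ Finset.range l, x ^ i / (i.factorial : ℝ)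

@[simp] theorem poi_zero_left (x : ℝ) : poi 0 x = 0 := by simp [poi]

theorem poi_succ (l : ℕ) (x : ℝ) :
    poi (l + 1) x = poi l x + Real.exp (-x) * (x ^ l / (l.factorial : ℝ)) := by
  rw [poi, poi, Finset.sum_range_succ, mul_add]

theorem poi_nonneg (l : ℕ) {x : ℝ} (hx : 0 ≤ x) : 0 ≤ poi l x := by
  unfold poi
  positivity

theorem poi_mono_left {l m : ℕ} (hlm : l ≤ m) {x : ℝ} (hx : 0 ≤ x) : poi l x ≤ poi m x := by
  unfold poi
  gcongr

/-- The polynomial factor increases with the mean, so only the exponential factor can lose. This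
compares weights before and after a step up to a constant factor. -/
theorem poi_le_exp_mul (l : ℕ) {x y : ℝ} (hx : 0 ≤ x) (hxy : x ≤ y) :
    poi l x ≤ Real.exp (y - x) * poi l y := by
  unfold poi
  rw [← mul_assoc, ← Real.exp_add]
  have : y - x + -y = -x := by ring
  rw [this]
  gcongr

/-- The backward equation of the Poisson process: the terms of the differentiated sum telescope. It
is the source of all the approximate martingales. The truncated `l - 1` is harmless at `l = 0`,
where both sides vanish. -/
theorem hasDerivAt_poi (l : ℕ) (x : ℝ) : HasDerivAt (poi l) (poi (l - 1) x - poi l x) x := by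
  induction l with
  | zero =>
    have : poi 0 = fun _ => (0 : ℝ) := funext poi_zero_left
    rw [this]
    simpa using hasDerivAt_const x (0 : ℝ)
  | succ l ih =>
    have h1 : HasDerivAt (fun x : ℝ => Real.exp (-x) * (x ^ l / (l.factorial : ℝ)))
        (Real.exp (-x) * (-1) * (x ^ l / (l.factorial : ℝ)) +
          Real.exp (-x) * (((l : ℝ) * x ^ (l - 1)) / (l.factorial : ℝ))) x :=
      ((hasDerivAt_neg x).exp).mul ((hasDerivAt_pow l x).div_const _)
    have h2 := ih.add h1
    have h3 : poi (l + 1) = poi l + fun x : ℝ => Real.exp (-x) * (x ^ l / (l.factorial : ℝ)) :=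
      funext fun y => poi_succ l y
    rw [h3]
    refine h2.congr_deriv ?_
    simp only [Nat.add_sub_cancel]
    rw [← h3, poi_succ]
    cases l with
    | zero => simp
    | succ k =>
      simp only [Nat.add_sub_cancel]
      rw [poi_succ k, Nat.factorial_succ]
      push_cast
      field_simp
      ring

theorem poi_antitone (l : ℕ) {x y : ℝ} (hx : 0 ≤ x) (hxy : x ≤ y) : poi l y ≤ poi l x := by
  have h := antitoneOn_of_deriv_nonpos (f := poi l) (convex_Ici (0 : ℝ))
    (fun z _ => (hasDerivAt_poi l z).continuousAt.continuousWithinAt)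
    (fun z _ => (hasDerivAt_poi l z).differentiableAt.differentiableWithinAt)
    (fun z hz => by
      rw [interior_Ici] at hz
      rw [(hasDerivAt_poi l z).deriv]
      linarith [poi_mono_left (Nat.sub_le l 1) (le_of_lt hz)])
  exact h hx (hx.trans hxy) hxy

theorem poi_at_zero (l : ℕ) : poi (l + 1) 0 = 1 := by
  simp [poi, Finset.sum_range_succ', Nat.factorial]

theorem poi_le_one (l : ℕ) {x : ℝ} (hx : 0 ≤ x) : poi l x ≤ 1 :=
  (poi_mono_left (Nat.le_succ l) hx).trans
    ((poi_antitone (l + 1) le_rfl hx).trans (poi_at_zero l).le)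

theorem exp_neg_le_poi (l : ℕ) {x : ℝ} (hx : 0 ≤ x) : Real.exp (-x) ≤ poi (l + 1) x := by
  refine le_trans ?_ (poi_mono_left (Nat.le_add_left 1 l) hx)
  simp [poi]

/-- The second derivative is again a combination of Poisson tails, bounded by `poi l` and hence by
its value at `x`. The error is therefore relative to the weight, which matters because the weights
become as small as order `1 / n`. -/
theorem abs_poi_taylor_le (l : ℕ) {x δ : ℝ} (hx : 0 ≤ x) (hδ : 0 ≤ δ) :
    |poi l (x + δ) - (poi l x - δ * (poi l x - poi (l - 1) x))| ≤ δ ^ 2 * poi l x := by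
  have h1 : ∀ y ∈ Set.Icc 0 δ,
      |(poi (l - 1) (x + y) - poi l (x + y)) - (poi (l - 1) x - poi l x)| ≤ δ * poi l x := by
    intro y hy
    have := Convex.norm_image_sub_le_of_norm_hasDerivWithin_le (f := fun z => poi (l - 1) z - poi l z)
      (f' := fun z => (poi (l - 1 - 1) z - poi (l - 1) z) - (poi (l - 1) z - poi l z))
      (C := poi l x) (s := Set.Icc x (x + y)) (x := x) (y := x + y)
      (fun z _ => ((hasDerivAt_poi (l - 1) z).sub (hasDerivAt_poi l z)).hasDerivWithinAt)
      (fun z hz => ?_) (convex_Icc _ _) (Set.left_mem_Icc.2 (by linarith [hy.1]))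
      (Set.right_mem_Icc.2 (by linarith [hy.1]))
    · rw [Real.norm_eq_abs, Real.norm_eq_abs, add_sub_cancel_left, abs_of_nonneg hy.1] at this
      refine this.trans ?_
      rw [mul_comm]
      exact mul_le_mul_of_nonneg_right hy.2 (poi_nonneg l hx)
    · have hz0 : 0 ≤ z := hx.trans hz.1
      have a1 := poi_mono_left (Nat.sub_le l 1) hz0
      have a2 := poi_mono_left (Nat.sub_le (l - 1) 1) hz0
      have a3 := poi_nonneg (l - 1 - 1) hz0
      have a4 := poi_antitone l hx hz.1
      rw [Real.norm_eq_abs, abs_le]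
      constructor <;> linarith
  have h2 := Convex.norm_image_sub_le_of_norm_hasDerivWithin_le
    (f := fun y => poi l (x + y) + y * (poi l x - poi (l - 1) x))
    (f' := fun y => (poi (l - 1) (x + y) - poi l (x + y)) - (poi (l - 1) x - poi l x))
    (C := δ * poi l x) (s := Set.Icc 0 δ) (x := 0) (y := δ)
    (fun y _ => by
      have h3 : HasDerivAt (fun y => poi l (x + y)) (poi (l - 1) (x + y) - poi l (x + y)) y :=
        (hasDerivAt_poi l (x + y)).comp_const_add x y
      have h4 := h3.add ((hasDerivAt_id y).mul_const (poi l x - poi (l - 1) x))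
      exact (h4.congr_deriv (by ring)).hasDerivWithinAt)
    h1 (convex_Icc _ _) (Set.left_mem_Icc.2 hδ) (Set.right_mem_Icc.2 hδ)
  rw [Real.norm_eq_abs, Real.norm_eq_abs, sub_zero, abs_of_nonneg hδ] at h2
  simp only [add_zero, zero_mul] at h2
  have e1 : poi l (x + δ) - (poi l x - δ * (poi l x - poi (l - 1) x)) =
    poi l (x + δ) + δ * (poi l x - poi (l - 1) x) - poi l x := by ring
  rw [e1]
  refine h2.trans (le_of_eq ?_)
  ring

end

/-! ### One step of the process for abstract vertex weights -/

section
open Classical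

variable {d n : ℕ}

theorem sum_sum_ne_mul {ι : Type*} [Fintype ι] [DecidableEq ι] (x : ι → ℝ) :
    ∑ u, ∑ v, (if u = v then 0 else x u * x v) = (∑ v, x v) ^ 2 - ∑ v, x v ^ 2 := by
  have : ∀ u v, (if u = v then 0 else x u * x v) = x u * x v - if u = v then x u * x v else 0 := by
    intro u v
    split_ifs <;> ring
  simp_rw [this, Finset.sum_sub_distrib]
  rw [pow_two, Finset.sum_mul_sum]
  simp [pow_two]

theorem abs_prod_add_sub_prod_le {ι : Type*} (s : Finset ι) {a g : ι → ℝ}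
    (ha : ∀ i, 0 ≤ a i ∧ a i ≤ 1) (hg : ∀ i, 0 ≤ a i + g i ∧ a i + g i ≤ 1) :
    |∏ i ∈ s, (a i + g i) - ∏ i ∈ s, a i| ≤ ∑ i ∈ s, |g i| := by
  induction s using Finset.induction_on with
  | empty => simp
  | insert i s hi ih =>
    rw [Finset.prod_insert hi, Finset.prod_insert hi, Finset.sum_insert hi]
    have h1 : ∏ j ∈ s, (a j + g j) ≤ 1 := Finset.prod_le_one (fun j _ => (hg j).1) fun j _ => (hg j).2
    have h2 : 0 ≤ ∏ j ∈ s, (a j + g j) := Finset.prod_nonneg fun j _ => (hg j).1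
    have e : (a i + g i) * ∏ j ∈ s, (a j + g j) - a i * ∏ j ∈ s, a j =
      g i * ∏ j ∈ s, (a j + g j) + a i * (∏ j ∈ s, (a j + g j) - ∏ j ∈ s, a j) := by ring
    rw [e]
    refine (abs_add_le _ _).trans ?_
    rw [abs_mul, abs_mul, abs_of_nonneg h2, abs_of_nonneg (ha i).1]
    have h3 := mul_le_mul_of_nonneg_left h1 (abs_nonneg (g i))
    have h4 := mul_le_mul_of_nonneg_right (ha i).2 (abs_nonneg (∏ j ∈ s, (a j + g j) - ∏ j ∈ s, a j))
    linarith

/-- The expansion to first order of a product of numbers in the unit interval; the error is at most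
the sum of the second-order terms. -/
theorem exists_prod_expansion {ι : Type*} (s : Finset ι) {a : ι → ℝ}
    (ha : ∀ i, 0 ≤ a i ∧ a i ≤ 1) :
    ∃ c : ι → ℝ, (∀ i, |c i| ≤ 1) ∧ ∀ g : ι → ℝ, (∀ i, 0 ≤ a i + g i ∧ a i + g i ≤ 1) →
      |∏ i ∈ s, (a i + g i) - (∏ i ∈ s, a i + ∑ i ∈ s, c i * g i)| ≤
        (∑ i ∈ s, |g i|) ^ 2 - ∑ i ∈ s, |g i| ^ 2 := by
  induction s using Finset.induction_on with
  | empty => exact ⟨0, by simp, by simp⟩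
  | insert i s hi ih =>
    obtain ⟨c, hc, h⟩ := ih
    have p1 : ∏ j ∈ s, a j ≤ 1 := Finset.prod_le_one (fun j _ => (ha j).1) fun j _ => (ha j).2
    have p2 : 0 ≤ ∏ j ∈ s, a j := Finset.prod_nonneg fun j _ => (ha j).1
    refine ⟨fun j => if j = i then ∏ j ∈ s, a j else a i * c j, fun j => ?_, fun g hg => ?_⟩
    · dsimp only
      split_ifs
      · rwa [abs_of_nonneg p2]
      · rw [abs_mul, abs_of_nonneg (ha i).1]
        exact mul_le_one₀ (ha i).2 (abs_nonneg _) (hc j)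
    · rw [Finset.prod_insert hi, Finset.prod_insert hi, Finset.sum_insert hi, Finset.sum_insert hi,
        Finset.sum_insert hi]
      simp only [if_true]
      have e1 : ∑ j ∈ s, (if j = i then ∏ j ∈ s, a j else a i * c j) * g j =
          a i * ∑ j ∈ s, c j * g j := by
        rw [Finset.mul_sum]
        refine Finset.sum_congr rfl fun j hj => ?_
        rw [if_neg (by rintro rfl; exact hi hj), mul_assoc]
      rw [e1]
      have h1 := h g hg
      have h2 := abs_prod_add_sub_prod_le s ha hg
      set P' := ∏ j ∈ s, (a j + g j)
      set P := ∏ j ∈ s, a j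
      set L := ∑ j ∈ s, c j * g j
      have e2 : (a i + g i) * P' - (a i * P + (P * g i + a i * L)) =
          a i * (P' - (P + L)) + g i * (P' - P) := by ring
      rw [e2]
      refine (abs_add_le _ _).trans ?_
      rw [abs_mul, abs_mul, abs_of_nonneg (ha i).1]
      have h3 := mul_le_mul_of_nonneg_left h2 (abs_nonneg (g i))
      have h4 := mul_le_mul_of_nonneg_right (ha i).2 (abs_nonneg (P' - (P + L)))
      have h5 : 0 ≤ |g i| * ∑ j ∈ s, |g j| := by positivity
      nlinarith

/-- The weights `q` before a step, and the weights after it: `α v - γ v` if the new edge contains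
`v`, and `α v` otherwise. The new edge contains `v` with probability about `δ`. -/
structure StepBounds (d : ℕ) (h : EdgeHistory n) (α γ q : Fin n → ℝ) (δ ε : ℝ) : Prop where
  nonempty : (allowedPairs d (graphAt h h.length)).Nonempty
  γ_nonneg : ∀ v, 0 ≤ γ v
  γ_le : ∀ v, γ v ≤ α v
  α_le_one : ∀ v, α v ≤ 1
  q_nonneg : ∀ v, 0 ≤ q v
  q_le : ∀ v, q v ≤ α v
  le_q : ∀ v, α v ≤ 3 * q v
  δ_nonneg : 0 ≤ δ
  δ_le_one : δ ≤ 1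
  δ_sq_le : δ ^ 2 ≤ ε
  prob : ∀ v, |stepProb d h (v ∈ ·) - δ| * γ v ≤ ε * α v
  prob_pair : ∀ u v, u ≠ v → stepProb d h (fun e => u ∈ e ∧ v ∈ e) ≤ ε
  taylor : ∀ v, |q v - (α v - δ * γ v)| ≤ δ ^ 2 * α v

namespace StepBounds

variable {h : EdgeHistory n} {α γ q : Fin n → ℝ} {δ ε : ℝ}

theorem α_nonneg (H : StepBounds d h α γ q δ ε) (v : Fin n) : 0 ≤ α v :=
  (H.γ_nonneg v).trans (H.γ_le v)

theorem ε_nonneg (H : StepBounds d h α γ q δ ε) : 0 ≤ ε := (sq_nonneg δ).trans H.δ_sq_le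

theorem edgeMean_weight (H : StepBounds d h α γ q δ ε) (v : Fin n) :
    edgeMean d h (fun e => α v - γ v * if v ∈ e then 1 else 0) =
      α v - γ v * stepProb d h (v ∈ ·) := by
  rw [edgeMean_sub, edgeMean_const H.nonempty, edgeMean_mul_left, edgeMean_indicator]

theorem edgeMean_weight_mul (H : StepBounds d h α γ q δ ε) (u v : Fin n) :
    edgeMean d h (fun e => (α u - γ u * if u ∈ e then 1 else 0) *
      (α v - γ v * if v ∈ e then 1 else 0)) =
      α u * α v - γ u * α v * stepProb d h (u ∈ ·) - α u * γ v * stepProb d h (v ∈ ·) +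
        γ u * γ v * stepProb d h (fun e => u ∈ e ∧ v ∈ e) := by
  have : (fun e : Sym2 (Fin n) => (α u - γ u * if u ∈ e then (1 : ℝ) else 0) *
      (α v - γ v * if v ∈ e then 1 else 0)) = fun e =>
      ((α u * α v - (γ u * α v) * if u ∈ e then 1 else 0) -
        (α u * γ v) * if v ∈ e then 1 else 0) + (γ u * γ v) * if u ∈ e ∧ v ∈ e then 1 else 0 := by
    funext e
    by_cases h1 : u ∈ e <;> by_cases h2 : v ∈ e <;> simp [h1, h2] <;> ring
  rw [this, edgeMean_add, edgeMean_sub, edgeMean_sub, edgeMean_const H.nonempty,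
    edgeMean_mul_left, edgeMean_mul_left, edgeMean_mul_left, edgeMean_indicator,
    edgeMean_indicator, edgeMean_indicator]

theorem sum_α_le (H : StepBounds d h α γ q δ ε) : ∑ v, α v ≤ 3 * ∑ v, q v := by
  rw [Finset.mul_sum]
  exact Finset.sum_le_sum fun v _ => H.le_q v

/-- The approximate martingale property of a single weight: replacing the true probability by `δ`
costs `ε * α v`, and the Taylor error costs at most as much again. -/
theorem abs_weight_sub_le (H : StepBounds d h α γ q δ ε) (v : Fin n) :
    |α v - γ v * stepProb d h (v ∈ ·) - q v| ≤ 2 * ε * α v := by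
  have e : α v - γ v * stepProb d h (v ∈ ·) - q v =
      -((stepProb d h (v ∈ ·) - δ) * γ v) - (q v - (α v - δ * γ v)) := by ring
  rw [e]
  refine (abs_sub _ _).trans ?_
  rw [abs_neg, abs_mul, abs_of_nonneg (H.γ_nonneg v)]
  have := H.taylor v
  have := H.prob v
  have := mul_le_mul_of_nonneg_right H.δ_sq_le (H.α_nonneg v)
  linarith

theorem abs_edgeMean_sum_sub_le (H : StepBounds d h α γ q δ ε) :
    |edgeMean d h (fun e => ∑ v, (α v - γ v * if v ∈ e then 1 else 0)) - ∑ v, q v| ≤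
      6 * ε * ∑ v, q v := by
  rw [edgeMean_sum, ← Finset.sum_sub_distrib]
  simp_rw [H.edgeMean_weight]
  refine (Finset.abs_sum_le_sum_abs _ _).trans ?_
  refine (Finset.sum_le_sum fun v _ => H.abs_weight_sub_le v).trans ?_
  rw [← Finset.mul_sum]
  have := mul_le_mul_of_nonneg_left H.sum_α_le H.ε_nonneg
  linarith

theorem abs_pair_sub_le (H : StepBounds d h α γ q δ ε) {u v : Fin n} (huv : u ≠ v) :
    |edgeMean d h (fun e => (α u - γ u * if u ∈ e then 1 else 0) *
      (α v - γ v * if v ∈ e then 1 else 0)) - q u * q v| ≤ 81 * ε * (q u * q v) := by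
  rw [H.edgeMean_weight_mul]
  have hε := H.ε_nonneg
  have au := H.α_nonneg u
  have av := H.α_nonneg v
  -- The four terms are bounded by `2`, `2`, `1` and `4` times `ε * (α u * α v)`; passing from `α`
  -- to `q` costs `3 * 3`, whence `81`.
  have e : α u * α v - γ u * α v * stepProb d h (u ∈ ·) - α u * γ v * stepProb d h (v ∈ ·) +
        γ u * γ v * stepProb d h (fun e => u ∈ e ∧ v ∈ e) - q u * q v =
      (α u - γ u * stepProb d h (u ∈ ·) - q u) * α v +
      (α v - γ v * stepProb d h (v ∈ ·) - q v) * α u +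
      γ u * γ v * stepProb d h (fun e => u ∈ e ∧ v ∈ e) -
      (α u - q u) * (α v - q v) := by ring
  have hq : ∀ w, 0 ≤ α w - q w ∧ α w - q w ≤ 2 * δ * α w := by
    intro w
    refine ⟨sub_nonneg.2 (H.q_le w), ?_⟩
    have h1 := (abs_le.1 (H.taylor w)).1
    have h2 := mul_le_mul_of_nonneg_left (H.γ_le w) H.δ_nonneg
    have h3 : δ ^ 2 * α w ≤ δ * α w := by
      refine mul_le_mul_of_nonneg_right ?_ (H.α_nonneg w)
      nlinarith [H.δ_nonneg, H.δ_le_one]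
    linarith
  have t1 : |(α u - γ u * stepProb d h (u ∈ ·) - q u) * α v| ≤ 2 * ε * (α u * α v) := by
    rw [abs_mul, abs_of_nonneg av]
    have := mul_le_mul_of_nonneg_right (H.abs_weight_sub_le u) av
    linarith
  have t2 : |(α v - γ v * stepProb d h (v ∈ ·) - q v) * α u| ≤ 2 * ε * (α u * α v) := by
    rw [abs_mul, abs_of_nonneg au]
    have := mul_le_mul_of_nonneg_right (H.abs_weight_sub_le v) au
    linarith
  have hγ : γ u * γ v ≤ α u * α v := mul_le_mul (H.γ_le u) (H.γ_le v) (H.γ_nonneg v) au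
  have hγ0 : 0 ≤ γ u * γ v := mul_nonneg (H.γ_nonneg u) (H.γ_nonneg v)
  have t3 : γ u * γ v * stepProb d h (fun e => u ∈ e ∧ v ∈ e) ≤ ε * (α u * α v) := by
    rw [mul_comm ε]
    exact mul_le_mul hγ (H.prob_pair u v huv) (stepProb_nonneg _ _) (mul_nonneg au av)
  have t3' : 0 ≤ γ u * γ v * stepProb d h (fun e => u ∈ e ∧ v ∈ e) :=
    mul_nonneg hγ0 (stepProb_nonneg _ _)
  have t4 : (α u - q u) * (α v - q v) ≤ 4 * ε * (α u * α v) := by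
    calc (α u - q u) * (α v - q v) ≤ (2 * δ * α u) * (2 * δ * α v) :=
          mul_le_mul (hq u).2 (hq v).2 (hq v).1 ((hq u).1.trans (hq u).2)
      _ = 4 * δ ^ 2 * (α u * α v) := by ring
      _ ≤ 4 * ε * (α u * α v) := by
        have := H.δ_sq_le
        gcongr
  have t4' : 0 ≤ (α u - q u) * (α v - q v) := mul_nonneg (hq u).1 (hq v).1
  have t5 : ε * (α u * α v) ≤ ε * (9 * (q u * q v)) := by
    refine mul_le_mul_of_nonneg_left ?_ hε
    have := mul_le_mul (H.le_q u) (H.le_q v) av (by linarith [H.q_nonneg u])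
    linarith
  rw [e]
  rw [abs_le] at t1 t2 ⊢
  constructor <;> linarith

theorem abs_edgeMean_pairs_sub_le (H : StepBounds d h α γ q δ ε) :
    |edgeMean d h (fun e => ∑ u, ∑ v, if u = v then 0 else
      (α u - γ u * if u ∈ e then 1 else 0) * (α v - γ v * if v ∈ e then 1 else 0)) -
        ∑ u, ∑ v, (if u = v then 0 else q u * q v)| ≤
      81 * ε * ∑ u, ∑ v, (if u = v then 0 else q u * q v) := by
  rw [edgeMean_sum, ← Finset.sum_sub_distrib, Finset.mul_sum]
  refine (Finset.abs_sum_le_sum_abs _ _).trans (Finset.sum_le_sum fun u _ => ?_)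
  rw [edgeMean_sum, ← Finset.sum_sub_distrib, Finset.mul_sum]
  refine (Finset.abs_sum_le_sum_abs _ _).trans (Finset.sum_le_sum fun v _ => ?_)
  by_cases huv : u = v
  · simp only [if_pos huv, edgeMean_const H.nonempty]
    simp
  · simp only [if_neg huv]
    exact H.abs_pair_sub_le huv

/-- Both products are expanded around `∏ v, (1 - α v)` with the same first-order coefficients, so
the linear parts agree on average by `abs_weight_sub_le`. The second-order terms involve pairs:
before the step they carry a factor `δ ^ 2`, after it the probability that one edge contains both
vertices. Here `45` is `(4 + 1) * 9`. -/
theorem abs_edgeMean_prod_sub_le (H : StepBounds d h α γ q δ ε) :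
    |edgeMean d h (fun e => ∏ v, (1 - (α v - γ v * if v ∈ e then 1 else 0))) -
        ∏ v, (1 - q v)| ≤ 6 * ε * ∑ v, q v + 45 * ε * (∑ v, q v) ^ 2 := by
  have hε := H.ε_nonneg
  obtain ⟨c, hc, hexp⟩ := exists_prod_expansion Finset.univ (a := fun v => 1 - α v)
    (fun v => ⟨by linarith [H.α_le_one v], by linarith [H.α_nonneg v]⟩)
  have hα0 : 0 ≤ ∑ v, α v := Finset.sum_nonneg fun v _ => H.α_nonneg v
  -- the product before the step
  have h1 := hexp (fun v => α v - q v)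
    (fun v => ⟨by linarith [H.q_le v, (H.q_le v).trans (H.α_le_one v)], by linarith [H.q_nonneg v]⟩)
  have h1' : (∑ v, |α v - q v|) ^ 2 - ∑ v, |α v - q v| ^ 2 ≤ 4 * ε * (∑ v, α v) ^ 2 := by
    have hb : ∑ v, |α v - q v| ≤ 2 * δ * ∑ v, α v := by
      rw [Finset.mul_sum]
      refine Finset.sum_le_sum fun w _ => ?_
      rw [abs_of_nonneg (sub_nonneg.2 (H.q_le w))]
      have h1 := (abs_le.1 (H.taylor w)).1
      have h2 := mul_le_mul_of_nonneg_left (H.γ_le w) H.δ_nonneg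
      have h3 : δ ^ 2 * α w ≤ δ * α w := by
        refine mul_le_mul_of_nonneg_right ?_ (H.α_nonneg w)
        nlinarith [H.δ_nonneg, H.δ_le_one]
      linarith
    have hs : 0 ≤ ∑ v, |α v - q v| ^ 2 := Finset.sum_nonneg fun _ _ => sq_nonneg _
    have hb2 : (∑ v, |α v - q v|) ^ 2 ≤ (2 * δ * ∑ v, α v) ^ 2 :=
      pow_le_pow_left₀ (Finset.sum_nonneg fun _ _ => abs_nonneg _) hb 2
    have := mul_le_mul_of_nonneg_right H.δ_sq_le (sq_nonneg (∑ v, α v))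
    nlinarith
  -- the product after the step
  have h2 : ∀ e : Sym2 (Fin n), |∏ v, (1 - (α v - γ v * if v ∈ e then 1 else 0)) -
      (∏ v, (1 - α v) + ∑ v, c v * (γ v * if v ∈ e then 1 else 0))| ≤
      ∑ u, ∑ v, if u = v then 0 else (γ u * γ v) * if u ∈ e ∧ v ∈ e then 1 else 0 := by
    intro e
    have hg0 : ∀ v, 0 ≤ (γ v * if v ∈ e then 1 else 0) ∧ (γ v * if v ∈ e then 1 else 0) ≤ α v := by
      intro v
      split_ifs
      · simp [H.γ_nonneg v, H.γ_le v]
      · simp [H.α_nonneg v]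
    have h3 := hexp (fun v => γ v * if v ∈ e then 1 else 0)
      (fun v => ⟨by linarith [H.α_le_one v, (hg0 v).1], by linarith [(hg0 v).2]⟩)
    rw [← sum_sum_ne_mul] at h3
    have e4 : ∏ v, (1 - (α v - γ v * if v ∈ e then 1 else 0)) =
        ∏ v, (1 - α v + γ v * if v ∈ e then 1 else 0) :=
      Finset.prod_congr rfl fun v _ => by ring
    rw [e4]
    refine h3.trans (le_of_eq ?_)
    · refine Finset.sum_congr rfl fun u _ => Finset.sum_congr rfl fun v _ => ?_
      rw [abs_of_nonneg (hg0 u).1, abs_of_nonneg (hg0 v).1]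
      by_cases h1 : u ∈ e <;> by_cases h2 : v ∈ e <;> simp [h1, h2]
  have h4 : |edgeMean d h (fun e => ∏ v, (1 - (α v - γ v * if v ∈ e then 1 else 0))) -
      (∏ v, (1 - α v) + ∑ v, c v * (γ v * stepProb d h (v ∈ ·)))| ≤ ε * (∑ v, α v) ^ 2 := by
    have e1 : ∏ v, (1 - α v) + ∑ v, c v * (γ v * stepProb d h (v ∈ ·)) =
        edgeMean d h (fun e => ∏ v, (1 - α v) + ∑ v, c v * (γ v * if v ∈ e then 1 else 0)) := by
      rw [edgeMean_add, edgeMean_const H.nonempty, edgeMean_sum]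
      simp only [edgeMean_mul_left, edgeMean_indicator]
    rw [e1, ← edgeMean_sub]
    refine (abs_edgeMean_le _ _).trans ((edgeMean_mono h h2).trans ?_)
    rw [edgeMean_sum]
    rw [pow_two, Finset.sum_mul_sum, Finset.mul_sum]
    refine Finset.sum_le_sum fun u _ => ?_
    rw [edgeMean_sum, Finset.mul_sum]
    refine Finset.sum_le_sum fun v _ => ?_
    have hαα := mul_nonneg (H.α_nonneg u) (H.α_nonneg v)
    by_cases huv : u = v
    · simp only [if_pos huv, edgeMean_const H.nonempty]
      exact mul_nonneg hε hαα
    · simp only [if_neg huv, edgeMean_mul_left, edgeMean_indicator]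
      rw [mul_comm ε]
      exact mul_le_mul (mul_le_mul (H.γ_le u) (H.γ_le v) (H.γ_nonneg v) (H.α_nonneg u))
        (H.prob_pair u v huv) (stepProb_nonneg _ _) hαα
  have h5 : |∑ v, c v * (γ v * stepProb d h (v ∈ ·)) - ∑ v, c v * (α v - q v)| ≤
      2 * ε * ∑ v, α v := by
    rw [← Finset.sum_sub_distrib, Finset.mul_sum]
    refine (Finset.abs_sum_le_sum_abs _ _).trans (Finset.sum_le_sum fun v _ => ?_)
    rw [← mul_sub, abs_mul]
    have e2 : γ v * stepProb d h (v ∈ ·) - (α v - q v) =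
      -(α v - γ v * stepProb d h (v ∈ ·) - q v) := by ring
    rw [e2, abs_neg]
    have := mul_le_mul_of_nonneg_right (hc v)
      (abs_nonneg (α v - γ v * stepProb d h (v ∈ ·) - q v))
    linarith [H.abs_weight_sub_le v]
  have e3 : ∏ v, (1 - α v + (α v - q v)) = ∏ v, (1 - q v) :=
    Finset.prod_congr rfl fun v _ => by ring
  rw [e3] at h1
  have h6 := mul_le_mul_of_nonneg_left H.sum_α_le hε
  have h7 : ε * (∑ v, α v) ^ 2 ≤ ε * (9 * (∑ v, q v) ^ 2) := by
    refine mul_le_mul_of_nonneg_left ?_ hε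
    have := pow_le_pow_left₀ hα0 H.sum_α_le 2
    linarith
  have h8 := h1.trans h1'
  rw [abs_le] at h8 h4 h5 ⊢
  constructor <;> linarith

end StepBounds
end

/-! ### The clock, the Poisson weights and their approximate martingales -/

section
open Classical

variable {d n : ℕ}

/-- The clock of the process: it advances by `2 / U` in a step from a graph with `U` vertices of
degree less than `d`, which is about the probability that a given one of them gets an edge. -/
noncomputable def clock (d : ℕ) (h : EdgeHistory n) : ℝ :=
  ∑ i ∈ Finset.range h.length, 2 / ((unsat d (h.take i)).card : ℝ)

@[simp] theorem clock_nil : clock d ([] : EdgeHistory n) = 0 := by simp [clock]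

theorem clock_snoc (h : EdgeHistory n) (e : Sym2 (Fin n)) :
    clock d (h ++ [e]) = clock d h + 2 / ((unsat d h).card : ℝ) := by
  rw [clock, List.length_append, List.length_singleton, Finset.sum_range_succ, List.take_left]
  congr 1
  refine Finset.sum_congr rfl fun i hi => ?_
  rw [List.take_append_of_le_length (Finset.mem_range.1 hi).le]

/-- The weight of `v`: about the probability that its degree is at most `m` when the clock
reaches `a`. -/
noncomputable def wt (d m : ℕ) (a : ℝ) (h : EdgeHistory n) (v : Fin n) : ℝ :=
  poi (m + 1 - hdeg h v) (a - clock d h)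

noncomputable def sumW (d m : ℕ) (a : ℝ) (h : EdgeHistory n) : ℝ := ∑ v, wt d m a h v

noncomputable def pairW (d m : ℕ) (a : ℝ) (h : EdgeHistory n) : ℝ :=
  ∑ u, ∑ v, if u = v then 0 else wt d m a h u * wt d m a h v

noncomputable def prodW (d m : ℕ) (a : ℝ) (h : EdgeHistory n) : ℝ := ∏ v, (1 - wt d m a h v)

/-- The function that is `f` until the clock passes `a`, and `g` afterwards. -/
noncomputable def upTo (d : ℕ) (a : ℝ) (f g : EdgeHistory n → ℝ) (h : EdgeHistory n) : ℝ :=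
  if clock d h ≤ a then f h else g h

theorem wt_nonneg {m : ℕ} {a : ℝ} {h : EdgeHistory n} (ha : clock d h ≤ a) (v : Fin n) :
    0 ≤ wt d m a h v := poi_nonneg _ (by linarith)

theorem wt_le_one {m : ℕ} {a : ℝ} {h : EdgeHistory n} (ha : clock d h ≤ a) (v : Fin n) :
    wt d m a h v ≤ 1 := poi_le_one _ (by linarith)

theorem sumW_nonneg {m : ℕ} {a : ℝ} {h : EdgeHistory n} (ha : clock d h ≤ a) :
    0 ≤ sumW d m a h := Finset.sum_nonneg fun v _ => wt_nonneg ha v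

theorem pairW_nonneg {m : ℕ} {a : ℝ} {h : EdgeHistory n} (ha : clock d h ≤ a) :
    0 ≤ pairW d m a h := by
  refine Finset.sum_nonneg fun u _ => Finset.sum_nonneg fun v _ => ?_
  split_ifs
  · exact le_rfl
  · exact mul_nonneg (wt_nonneg ha u) (wt_nonneg ha v)

theorem prodW_nonneg {m : ℕ} {a : ℝ} {h : EdgeHistory n} (ha : clock d h ≤ a) :
    0 ≤ prodW d m a h := Finset.prod_nonneg fun v _ => sub_nonneg.2 (wt_le_one ha v)

theorem prodW_le_one {m : ℕ} {a : ℝ} {h : EdgeHistory n} (ha : clock d h ≤ a) :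
    prodW d m a h ≤ 1 := Finset.prod_le_one (fun v _ => sub_nonneg.2 (wt_le_one ha v))
      fun v _ => by linarith [wt_nonneg (m := m) ha v]

theorem sumW_sq_le {m : ℕ} {a : ℝ} {h : EdgeHistory n} (ha : clock d h ≤ a) :
    sumW d m a h ^ 2 ≤ pairW d m a h + sumW d m a h := by
  rw [pairW, sum_sum_ne_mul]
  have : ∑ v, wt d m a h v ^ 2 ≤ sumW d m a h := by
    refine Finset.sum_le_sum fun v _ => ?_
    nlinarith [wt_nonneg (m := m) ha v, wt_le_one (m := m) ha v]
  have e : sumW d m a h = ∑ v, wt d m a h v := rfl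
  rw [← e]
  linarith

/-- Puts the new weight in the form `α v - γ v * indicator` required by `StepBounds`. -/
theorem wt_snoc (m : ℕ) (a : ℝ) (h : EdgeHistory n) (e : Sym2 (Fin n)) (v : Fin n) :
    wt d m a (h ++ [e]) v =
      poi (m + 1 - hdeg h v) (a - clock d h - 2 / ((unsat d h).card : ℝ)) -
      (poi (m + 1 - hdeg h v) (a - clock d h - 2 / ((unsat d h).card : ℝ)) -
        poi (m + 1 - hdeg h v - 1) (a - clock d h - 2 / ((unsat d h).card : ℝ))) *
          if v ∈ e then 1 else 0 := by
  rw [wt, hdeg_snoc, clock_snoc, sub_add_eq_sub_sub]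
  split_ifs
  · rw [Nat.sub_add_eq]
    ring
  · simp

theorem two_div_card_le_one {h : EdgeHistory n} (hr : Reach d h)
    (hl : 2 * d * d + 2 * h.length < d * n) : 2 / ((unsat d h).card : ℝ) ≤ 1 := by
  have hU : (2 * d + 1 : ℝ) ≤ (unsat d h).card := by exact_mod_cast hr.two_mul_le_card hl
  have hd : (1 : ℝ) ≤ d := by
    have : d ≠ 0 := by
      rintro rfl
      simp at hl
    exact_mod_cast Nat.one_le_iff_ne_zero.2 this
  rw [div_le_one (by linarith)]
  linarith

theorem stepBounds {m : ℕ} (hm : m < d) {a : ℝ} {h : EdgeHistory n} (hr : Reach d h)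
    (hl : 2 * d * d + 2 * h.length < d * n)
    (ha : clock d h + 2 / ((unsat d h).card : ℝ) ≤ a) :
    StepBounds d h
      (fun v => poi (m + 1 - hdeg h v) (a - clock d h - 2 / ((unsat d h).card : ℝ)))
      (fun v => poi (m + 1 - hdeg h v) (a - clock d h - 2 / ((unsat d h).card : ℝ)) -
        poi (m + 1 - hdeg h v - 1) (a - clock d h - 2 / ((unsat d h).card : ℝ)))
      (wt d m a h) (2 / ((unsat d h).card : ℝ)) ((4 * d + 4) / ((unsat d h).card : ℝ) ^ 2) := by
  have hδ0 : 0 ≤ 2 / ((unsat d h).card : ℝ) := by positivity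
  have hδ1 := two_div_card_le_one hr hl
  have hεd : 4 * d / ((unsat d h).card : ℝ) ^ 2 ≤ (4 * d + 4) / ((unsat d h).card : ℝ) ^ 2 := by
    gcongr
    linarith
  have hε4 : 4 / ((unsat d h).card : ℝ) ^ 2 ≤ (4 * d + 4) / ((unsat d h).card : ℝ) ^ 2 := by
    gcongr
    have : (0 : ℝ) ≤ d := Nat.cast_nonneg d
    linarith
  have hx : 0 ≤ a - clock d h - 2 / ((unsat d h).card : ℝ) := by linarith
  have ht : ∀ v, wt d m a h v = poi (m + 1 - hdeg h v)
      (a - clock d h - 2 / ((unsat d h).card : ℝ) + 2 / ((unsat d h).card : ℝ)) := by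
    intro v
    rw [sub_add_cancel, wt]
  refine
    { nonempty := hr.allowed_nonempty hl
      γ_nonneg := fun v => sub_nonneg.2 (poi_mono_left (Nat.sub_le _ _) hx)
      γ_le := fun v => sub_le_self _ (poi_nonneg _ hx)
      α_le_one := fun v => poi_le_one _ hx
      q_nonneg := fun v => wt_nonneg (by linarith) v
      q_le := fun v => poi_antitone _ hx (by linarith)
      le_q := fun v => ?_
      δ_nonneg := hδ0
      δ_le_one := hδ1
      δ_sq_le := ?_
      prob := fun v => ?_
      prob_pair := fun u v huv => (hr.stepProb_pair_le hl huv).trans hε4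
      taylor := fun v => ?_ }
  · rw [ht]
    refine (poi_le_exp_mul _ hx (le_add_of_nonneg_right hδ0)).trans ?_
    refine mul_le_mul_of_nonneg_right ?_ (poi_nonneg _ (by linarith))
    rw [add_sub_cancel_left]
    exact (Real.exp_le_exp.2 hδ1).trans (by linarith [Real.exp_one_lt_d9])
  · rw [div_pow]
    refine le_trans (le_of_eq ?_) hε4
    norm_num
  -- The estimate of the edge probability is available only for unsaturated vertices. A saturated
  -- one has weight zero, because `m < d`.
  · by_cases hv : v ∈ unsat d h
    · refine mul_le_mul ((hr.abs_stepProb_sub_le hl hv).trans hεd)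
        (sub_le_self _ (poi_nonneg _ hx)) (sub_nonneg.2 (poi_mono_left (Nat.sub_le _ _) hx)) ?_
      positivity
    · rw [mem_unsat, not_lt] at hv
      have : m + 1 - hdeg h v = 0 := by omega
      simp [this]
  · rw [ht]
    exact abs_poi_taylor_le _ hx hδ0

/-- The error allowed in step `s`. -/
noncomputable def stepErr (d n s : ℕ) : ℝ := 81 * (4 * d + 4) * d ^ 2 / ((d : ℝ) * n - 2 * s) ^ 2

theorem stepErr_nonneg (d n s : ℕ) : 0 ≤ stepErr d n s := by
  unfold stepErr
  positivity

theorem eps_le_stepErr {h : EdgeHistory n} (hr : Reach d h)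
    (hl : 2 * d * d + 2 * h.length < d * n) :
    81 * ((4 * d + 4) / ((unsat d h).card : ℝ) ^ 2) ≤ stepErr d n h.length := by
  have hU : (2 * d + 1 : ℝ) ≤ (unsat d h).card := by exact_mod_cast hr.two_mul_le_card hl
  have h1 : (d * n : ℝ) ≤ d * (unsat d h).card + 2 * h.length := by exact_mod_cast hr.le_card_unsat
  have h2 : (2 * d * d + 2 * h.length : ℝ) < d * n := by exact_mod_cast hl
  have hd : (0 : ℝ) ≤ d := Nat.cast_nonneg d
  have hD : 0 < (d : ℝ) * n - 2 * h.length := by nlinarith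
  have hU0 : (0 : ℝ) < (unsat d h).card := by linarith
  rw [stepErr, ← mul_div_assoc, div_le_div_iff₀ (by positivity) (by positivity)]
  have h3 : ((d : ℝ) * n - 2 * h.length) ^ 2 ≤ (d * (unsat d h).card) ^ 2 :=
    pow_le_pow_left₀ hD.le (by linarith) 2
  rw [mul_pow] at h3
  have h4 : (0 : ℝ) ≤ 81 * (4 * d + 4) := by positivity
  have h5 := mul_le_mul_of_nonneg_left h3 h4
  linarith

/-- Telescoping: the number of missing half-edges drops by 2 per step, and `1 / (x + 2) ^ 2 ≤ 1 / x
- 1 / (x + 2)`. The sum is governed by its last terms. -/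
theorem sum_stepErr_le {T : ℕ} (hd : 0 < d) (hT : 2 * d * d + 2 * T ≤ d * n) :
    ∑ i ∈ Finset.range T, stepErr d n i ≤
      81 * (4 * d + 4) * d ^ 2 / ((d : ℝ) * n - 2 * T) := by
  have hd' : (1 : ℝ) ≤ d := by exact_mod_cast hd
  have key : ∀ k ≤ T, ∑ i ∈ Finset.range k, stepErr d n i ≤
      81 * (4 * d + 4) * d ^ 2 * (1 / ((d : ℝ) * n - 2 * k)) := by
    intro k hk
    induction k with
    | zero =>
      have : (0 : ℝ) ≤ (d : ℝ) * n - 2 * (0 : ℕ) := by simp; positivity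
      rw [Finset.sum_range_zero]
      positivity
    | succ k ih =>
      rw [Finset.sum_range_succ]
      have h1 : (2 * d * d + 2 * (k + 1) : ℝ) ≤ d * n := by
        have : 2 * d * d + 2 * (k + 1) ≤ d * n := by omega
        exact_mod_cast this
      have hx : 0 < (d : ℝ) * n - 2 * (k + 1 : ℕ) := by push_cast; nlinarith
      have hx' : (d : ℝ) * n - 2 * k = (d : ℝ) * n - 2 * (k + 1 : ℕ) + 2 := by push_cast; ring
      refine (add_le_add_left (ih (by omega)) _).trans ?_
      rw [stepErr, div_eq_mul_one_div (81 * (4 * (d : ℝ) + 4) * d ^ 2), ← mul_add]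
      refine mul_le_mul_of_nonneg_left ?_ (by positivity)
      rw [hx']
      set x := (d : ℝ) * n - 2 * (k + 1 : ℕ)
      rw [div_add_div _ _ (by positivity) (by positivity), div_le_div_iff₀ (by positivity) hx]
      nlinarith [sq_nonneg x]
  rw [div_eq_mul_one_div]
  exact key T le_rfl

theorem stepMean_sumW {m : ℕ} (hm : m < d) {a : ℝ} {h : EdgeHistory n} (hr : Reach d h)
    (hl : 2 * d * d + 2 * h.length < d * n)
    (ha : clock d h + 2 / ((unsat d h).card : ℝ) ≤ a) :
    |stepMean d h (sumW d m a) - sumW d m a h| ≤ stepErr d n h.length * sumW d m a h := by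
  have H := stepBounds hm hr hl ha
  rw [stepMean_eq_edgeMean H.nonempty (fun e => by
    rw [sumW, Finset.sum_congr rfl fun v _ => wt_snoc m a h e v])]
  have h0 : 0 ≤ sumW d m a h := Finset.sum_nonneg fun v _ => H.q_nonneg v
  refine H.abs_edgeMean_sum_sub_le.trans (mul_le_mul_of_nonneg_right ?_ h0)
  linarith [eps_le_stepErr hr hl, H.ε_nonneg]

theorem stepMean_pairW {m : ℕ} (hm : m < d) {a : ℝ} {h : EdgeHistory n} (hr : Reach d h)
    (hl : 2 * d * d + 2 * h.length < d * n)
    (ha : clock d h + 2 / ((unsat d h).card : ℝ) ≤ a) :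
    |stepMean d h (pairW d m a) - pairW d m a h| ≤ stepErr d n h.length * pairW d m a h := by
  have H := stepBounds hm hr hl ha
  rw [stepMean_eq_edgeMean H.nonempty (fun e => by
    simp only [pairW, wt_snoc m a h e]
    rfl)]
  have h0 : 0 ≤ pairW d m a h :=
    pairW_nonneg (by linarith [H.δ_nonneg])
  exact H.abs_edgeMean_pairs_sub_le.trans
    (mul_le_mul_of_nonneg_right (eps_le_stepErr hr hl) h0)

theorem stepMean_prodW {m : ℕ} (hm : m < d) {a : ℝ} {h : EdgeHistory n} (hr : Reach d h)
    (hl : 2 * d * d + 2 * h.length < d * n)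
    (ha : clock d h + 2 / ((unsat d h).card : ℝ) ≤ a) :
    |stepMean d h (prodW d m a) - prodW d m a h| ≤
      stepErr d n h.length * (pairW d m a h + sumW d m a h) := by
  have H := stepBounds hm hr hl ha
  have ha' : clock d h ≤ a := by linarith [H.δ_nonneg]
  rw [stepMean_eq_edgeMean H.nonempty (fun e => by
    simp only [prodW, wt_snoc m a h e]
    rfl)]
  have h1 := sumW_nonneg (m := m) ha'
  have h2 := pairW_nonneg (m := m) ha'
  have h3 := sumW_sq_le (m := m) ha'
  refine H.abs_edgeMean_prod_sub_le.trans ?_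
  refine le_trans ?_ (mul_le_mul_of_nonneg_right (eps_le_stepErr hr hl) (add_nonneg h2 h1))
  have e : ∑ v, wt d m a h v = sumW d m a h := rfl
  rw [e]
  have hε := H.ε_nonneg
  set ε := (4 * d + 4) / ((unsat d h).card : ℝ) ^ 2
  have h4 := mul_le_mul_of_nonneg_left h3 hε
  have h5 := mul_nonneg hε h1
  have h6 := mul_nonneg hε h2
  linarith

theorem upTo_of_le {a : ℝ} {f g : EdgeHistory n → ℝ} {h : EdgeHistory n} (ha : clock d h ≤ a) :
    upTo d a f g h = f h := if_pos ha

theorem upTo_of_lt {a : ℝ} {f g : EdgeHistory n → ℝ} {h : EdgeHistory n} (ha : a < clock d h) :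
    upTo d a f g h = g h := if_neg ha.not_ge

/-- To bound the mean of `upTo d a f g` after a step, bound `f` as long as the clock does not
pass `a`, and `g` from the step on in which it does. -/
theorem stepMean_upTo_le {a : ℝ} {f g : EdgeHistory n → ℝ} {h : EdgeHistory n} {r : ℝ}
    (hr : Reach d h) (hl : 2 * d * d + 2 * h.length < d * n)
    (h1 : clock d h + 2 / ((unsat d h).card : ℝ) ≤ a → stepMean d h f ≤ f h + r)
    (h2 : clock d h ≤ a → a < clock d h + 2 / ((unsat d h).card : ℝ) →
      stepMean d h g ≤ f h + r)
    (h3 : a < clock d h → stepMean d h g ≤ g h + r) :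
    stepMean d h (upTo d a f g) ≤ upTo d a f g h + r := by
  have hne := hr.allowed_nonempty hl
  have hδ : (0 : ℝ) ≤ 2 / ((unsat d h).card : ℝ) := by positivity
  by_cases c1 : clock d h + 2 / ((unsat d h).card : ℝ) ≤ a
  · rw [upTo_of_le (by linarith)]
    refine (stepMean_mono_of_nonempty hne fun e _ => ?_).trans (h1 c1)
    rw [upTo_of_le (by rwa [clock_snoc])]
  · rw [not_le] at c1
    have : stepMean d h (upTo d a f g) ≤ stepMean d h g := by
      refine stepMean_mono_of_nonempty hne fun e _ => ?_
      rw [upTo_of_lt (by rwa [clock_snoc])]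
    refine this.trans ?_
    by_cases c2 : clock d h ≤ a
    · rw [upTo_of_le c2]
      exact h2 c2 c1
    · rw [upTo_of_lt (not_le.1 c2)]
      exact h3 (not_le.1 c2)

end

/-! ### Moment bounds along the run -/

section
open Classical

variable {d n : ℕ}

/-- The number of vertices of degree at most `m`. -/
noncomputable def lowCount (m : ℕ) (h : EdgeHistory n) : ℕ :=
  ({v | hdeg h v ≤ m} : Finset (Fin n)).card

/-- A bound for the sum of the errors of the first `T` steps. -/
noncomputable def totalErr (d n T : ℕ) : ℝ := 81 * (4 * d + 4) * d ^ 2 / ((d : ℝ) * n - 2 * T)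

/-- The probability that the run after `k` steps satisfies `p`. -/
noncomputable def runProb (d n k : ℕ) (p : EdgeHistory n → Prop) : ℝ :=
  runMean d n k (fun h => if p h then 1 else 0)

theorem lowCount_snoc_le (m : ℕ) (h : EdgeHistory n) (e : Sym2 (Fin n)) :
    lowCount m (h ++ [e]) ≤ lowCount m h := by
  refine Finset.card_le_card fun v hv => ?_
  simp only [Finset.mem_filter, Finset.mem_univ, true_and, hdeg_snoc] at hv ⊢
  omega

theorem card_unsat_eq_lowCount (hd : 0 < d) (h : EdgeHistory n) :
    (unsat d h).card = lowCount (d - 1) h := by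
  rw [lowCount, unsat]
  congr 1
  ext v
  simp only [Finset.mem_filter, Finset.mem_univ, true_and]
  omega

theorem card_mul_exp_le_sumW {m : ℕ} {a : ℝ} {h : EdgeHistory n} (ha : clock d h ≤ a) :
    lowCount m h * Real.exp (-(a - clock d h)) ≤ sumW d m a h := by
  rw [lowCount, ← nsmul_eq_mul, ← Finset.sum_const]
  refine (Finset.sum_le_sum fun v hv => ?_).trans
    (Finset.sum_le_sum_of_subset_of_nonneg (Finset.subset_univ _)
      fun v _ _ => wt_nonneg (m := m) ha v)
  simp only [Finset.mem_filter, Finset.mem_univ, true_and] at hv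
  rw [wt, Nat.succ_sub hv]
  exact exp_neg_le_poi _ (by linarith)

theorem sumW_le_card {m : ℕ} {a : ℝ} {h : EdgeHistory n} (ha : clock d h ≤ a) :
    sumW d m a h ≤ lowCount m h := by
  have h1 : sumW d m a h ≤ ∑ v, if hdeg h v ≤ m then (1 : ℝ) else 0 := by
    refine Finset.sum_le_sum fun v _ => ?_
    split_ifs with hv
    · exact wt_le_one ha v
    · rw [wt, show m + 1 - hdeg h v = 0 by omega, poi_zero_left]
  rwa [Finset.sum_boole] at h1

theorem sumW_nil (m : ℕ) (a : ℝ) : sumW d m a ([] : EdgeHistory n) = n * poi (m + 1) a := by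
  simp [sumW, wt]

theorem prodW_nil (m : ℕ) (a : ℝ) :
    prodW d m a ([] : EdgeHistory n) = (1 - poi (m + 1) a) ^ n := by
  simp [prodW, wt]

theorem pairW_nil (m : ℕ) (a : ℝ) : pairW d m a ([] : EdgeHistory n) =
    (n * poi (m + 1) a) ^ 2 - n * poi (m + 1) a ^ 2 := by
  rw [pairW, sum_sum_ne_mul]
  simp [wt]

/-- When the clock passes `a`, the remaining time was less than `2 / U ≤ 1`, so every vertex of
degree at most `m` had weight at least `exp (-1)`. From then on their number can only decrease, so
the bound survives until `T`. -/
theorem runMean_upTo_sumW_le {T m : ℕ} (hm : m < d) (hT : 2 * d * d + 2 * T ≤ d * n) {a : ℝ}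
    (ha : 0 ≤ a) (k : ℕ) (hk : k ≤ T) :
    runMean d n k (upTo d a (sumW d m a) (fun h => Real.exp (-1) * lowCount m h)) ≤
      Real.exp (totalErr d n T) * (n * poi (m + 1) a) := by
  have hf : ∀ h, 0 ≤ upTo d a (sumW d m a) (fun h : EdgeHistory n =>
      Real.exp (-1) * lowCount m h) h := by
    intro h
    unfold upTo
    split_ifs with hc
    · exact sumW_nonneg hc
    · positivity
  refine (runMean_le_exp_mul hT (ε := stepErr d n) hf (fun h hr hl => ?_) k hk).trans ?_
  · have hε := stepErr_nonneg d n h.length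
    have hl' : 2 * d * d + 2 * h.length < d * n := by omega
    have hmono : stepMean d h (fun h => Real.exp (-1) * (lowCount m h : ℝ)) ≤
        Real.exp (-1) * (lowCount m h : ℝ) := by
      refine (stepMean_mono_of_nonempty (g := fun _ => Real.exp (-1) * (lowCount m h : ℝ))
        (hr.allowed_nonempty hl') fun e _ => ?_).trans (stepMean_const _ _).le
      gcongr
      exact lowCount_snoc_le m h e
    have hr0 := mul_nonneg hε (hf h)
    refine stepMean_upTo_le hr hl' (fun c => ?_) (fun c1 c2 => ?_) (fun c => ?_)
    · have hδ : (0 : ℝ) ≤ 2 / ((unsat d h).card : ℝ) := by positivity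
      rw [upTo_of_le (by linarith)]
      linarith [(abs_le.1 (stepMean_sumW hm hr hl' c)).2]
    · refine (hmono.trans ?_).trans (le_add_of_nonneg_right hr0)
      refine le_trans ?_ (card_mul_exp_le_sumW c1)
      rw [mul_comm]
      gcongr
      linarith [two_div_card_le_one hr hl']
    · exact hmono.trans (le_add_of_nonneg_right hr0)
  · rw [upTo_of_le (by simpa using ha), sumW_nil]
    refine mul_le_mul_of_nonneg_right (Real.exp_le_exp.2 ?_)
      (mul_nonneg (Nat.cast_nonneg _) (poi_nonneg _ ha))
    exact (Finset.sum_le_sum_of_subset_of_nonneg (Finset.range_mono hk)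
      fun i _ _ => stepErr_nonneg d n i).trans (sum_stepErr_le (by omega) hT)

theorem runMean_upTo_pairW_le {T m : ℕ} (hm : m < d) (hT : 2 * d * d + 2 * T ≤ d * n) {a : ℝ}
    (ha : 0 ≤ a) (k : ℕ) (hk : k ≤ T) :
    runMean d n k (upTo d a (pairW d m a) (fun _ => 0)) ≤
      Real.exp (totalErr d n T) * (n * poi (m + 1) a) ^ 2 := by
  have hf : ∀ h, 0 ≤ upTo d a (pairW d m a) (fun _ : EdgeHistory n => 0) h := by
    intro h
    unfold upTo
    split_ifs with hc
    · exact pairW_nonneg hc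
    · exact le_rfl
  refine (runMean_le_exp_mul hT (ε := stepErr d n) hf (fun h hr hl => ?_) k hk).trans ?_
  · have hε := stepErr_nonneg d n h.length
    have hl' : 2 * d * d + 2 * h.length < d * n := by omega
    have hr0 := mul_nonneg hε (hf h)
    refine stepMean_upTo_le hr hl' (fun c => ?_) (fun c1 c2 => ?_) (fun c => ?_)
    · have hδ : (0 : ℝ) ≤ 2 / ((unsat d h).card : ℝ) := by positivity
      rw [upTo_of_le (by linarith)]
      linarith [(abs_le.1 (stepMean_pairW hm hr hl' c)).2]
    · rw [stepMean_const]
      exact add_nonneg (pairW_nonneg c1) hr0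
    · rw [stepMean_const, zero_add]
      exact hr0
  · rw [upTo_of_le (by simpa using ha), pairW_nil]
    have h1 : ∑ i ∈ Finset.range k, stepErr d n i ≤ totalErr d n T :=
      (Finset.sum_le_sum_of_subset_of_nonneg (Finset.range_mono hk)
        fun i _ _ => stepErr_nonneg d n i).trans (sum_stepErr_le (by omega) hT)
    have h2 : (0 : ℝ) ≤ n * poi (m + 1) a ^ 2 := by positivity
    calc _ ≤ Real.exp (∑ i ∈ Finset.range k, stepErr d n i) * (n * poi (m + 1) a) ^ 2 := by
          gcongr
          linarith
      _ ≤ _ := by gcongr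

/-- Functions whose mean changes in a step by little compared with the moments of the weights. -/
theorem runMean_le_of_weight_step {T m : ℕ} (hm : m < d) (hT : 2 * d * d + 2 * T ≤ d * n) {a c : ℝ}
    (ha : 0 ≤ a) (hc : 0 ≤ c) {f : EdgeHistory n → ℝ}
    (hstep : ∀ h, Reach d h → h.length < T → stepMean d h f ≤ f h + stepErr d n h.length *
      upTo d a (fun h => pairW d m a h + c * sumW d m a h) (fun _ => 0) h) :
    runMean d n T f ≤ f [] + totalErr d n T * (Real.exp (totalErr d n T) *
      ((n * poi (m + 1) a) ^ 2 + c * (n * poi (m + 1) a))) := by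
  refine (runMean_le_of_step hT hstep T le_rfl).trans ?_
  gcongr
  have h1 : ∀ i ∈ Finset.range T, stepErr d n i * runMean d n i
      (upTo d a (fun h => pairW d m a h + c * sumW d m a h) (fun _ => 0)) ≤
      stepErr d n i * (Real.exp (totalErr d n T) *
        ((n * poi (m + 1) a) ^ 2 + c * (n * poi (m + 1) a))) := by
    intro i hi
    have hi' := (Finset.mem_range.1 hi).le
    refine mul_le_mul_of_nonneg_left ?_ (stepErr_nonneg d n i)
    have h2 : runMean d n i
        (upTo d a (fun h => pairW d m a h + c * sumW d m a h) (fun _ => 0)) ≤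
        runMean d n i (fun h => upTo d a (pairW d m a) (fun _ => 0) h +
          c * upTo d a (sumW d m a) (fun h => Real.exp (-1) * lowCount m h) h) := by
      refine runMean_mono i (by omega) fun h _ _ => ?_
      unfold upTo
      split_ifs
      · exact le_rfl
      · positivity
    rw [runMean_add, runMean_smul] at h2
    have h3 := runMean_upTo_pairW_le hm hT ha i hi'
    have h4 := mul_le_mul_of_nonneg_left (runMean_upTo_sumW_le hm hT ha i hi') hc
    linarith
  refine (Finset.sum_le_sum h1).trans ?_
  rw [← Finset.sum_mul]
  have hp := poi_nonneg (m + 1) ha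
  exact mul_le_mul_of_nonneg_right (sum_stepErr_le (by omega) hT) (by positivity)

/-- The deviation of `sumW` from `μ`, corrected so that it is almost a martingale. -/
noncomputable def quadW (d : ℕ) (a μ : ℝ) (h : EdgeHistory n) : ℝ :=
  pairW d (d - 1) a h - (2 * μ - 1) * sumW d (d - 1) a h + μ ^ 2

/-- The difference of the two sides is the sum of `wt - wt ^ 2`. The right side uses `pairW` in
place of the square of `sumW`, since it is `pairW` that is almost a martingale. -/
theorem sq_sub_le_quadW {a μ : ℝ} {h : EdgeHistory n} (ha : clock d h ≤ a) :
    (sumW d (d - 1) a h - μ) ^ 2 ≤ quadW d a μ h := by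
  have := sumW_sq_le (m := d - 1) ha
  unfold quadW
  linarith

theorem stepMean_quadW_le (hd : 0 < d) {a μ : ℝ} (hμ : 0 ≤ μ) {h : EdgeHistory n} (hr : Reach d h)
    (hl : 2 * d * d + 2 * h.length < d * n)
    (ha : clock d h + 2 / ((unsat d h).card : ℝ) ≤ a) :
    stepMean d h (quadW d a μ) ≤ quadW d a μ h + stepErr d n h.length *
      (pairW d (d - 1) a h + (2 * μ + 1) * sumW d (d - 1) a h) := by
  have e : stepMean d h (quadW d a μ) = stepMean d h (pairW d (d - 1) a) -
      (2 * μ - 1) * stepMean d h (sumW d (d - 1) a) + μ ^ 2 := by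
    have : quadW d a μ = fun h : EdgeHistory n =>
        (pairW d (d - 1) a h + (-(2 * μ - 1)) * sumW d (d - 1) a h) + μ ^ 2 := by
      funext h
      unfold quadW
      ring
    rw [this, stepMean_add, stepMean_add, stepMean_smul, stepMean_const]
    ring
  have h1 := (abs_le.1 (stepMean_pairW (m := d - 1) (by omega) hr hl ha)).2
  have h2 := stepMean_sumW (m := d - 1) (by omega) hr hl ha
  have h3 : (2 * μ - 1) * (sumW d (d - 1) a h - stepMean d h (sumW d (d - 1) a)) ≤
      (2 * μ + 1) * (stepErr d n h.length * sumW d (d - 1) a h) := by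
    refine (le_abs_self _).trans ?_
    rw [abs_mul, abs_sub_comm (sumW _ _ _ _)]
    refine mul_le_mul ?_ h2 (abs_nonneg _) (by linarith)
    rw [abs_le]
    constructor <;> linarith
  rw [e]
  unfold quadW
  linarith

/-- A variance bound: the initial value is at most the mean `n * poi d a`, as for a sum of
independent indicators. At the crossing of `a` the weights sum to at least `U * exp (-2 / U) ≥ U -
2`, and `U` never increases, which is why the continuation involves `U - 2 - μ`. -/
theorem runMean_upTo_quadW_le (hd : 0 < d) {T : ℕ} (hT : 2 * d * d + 2 * T ≤ d * n) {a : ℝ}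
    (ha : 0 ≤ a) :
    runMean d n T (upTo d a (quadW d a (n * poi d a))
      (fun h => max ((unsat d h).card - 2 - n * poi d a) 0 ^ 2)) ≤
      n * poi d a + totalErr d n T * (Real.exp (totalErr d n T) *
        ((n * poi d a) ^ 2 + (2 * (n * poi d a) + 1) * (n * poi d a))) := by
  have hp := poi_nonneg d ha
  have hμ : 0 ≤ n * poi d a := by positivity
  have hdd : d - 1 + 1 = d := by omega
  set μ := n * poi d a with hμdef
  have key := runMean_le_of_weight_step (m := d - 1) (by omega) hT ha (c := 2 * μ + 1)
    (by linarith) (f := upTo d a (quadW d a μ)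
      (fun h : EdgeHistory n => max ((unsat d h).card - 2 - μ) 0 ^ 2)) (fun h hr hl => ?_)
  · rw [hdd, ← hμdef] at key
    refine key.trans ?_
    gcongr
    rw [upTo_of_le (by simpa using ha), quadW, pairW_nil, sumW_nil, hdd, ← hμdef]
    have : (0 : ℝ) ≤ n * poi d a ^ 2 := by positivity
    linarith
  · have hl' : 2 * d * d + 2 * h.length < d * n := by omega
    have hε := stepErr_nonneg d n h.length
    have hr0 : 0 ≤ stepErr d n h.length * upTo d a
        (fun h => pairW d (d - 1) a h + (2 * μ + 1) * sumW d (d - 1) a h) (fun _ => 0) h := by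
      refine mul_nonneg hε ?_
      unfold upTo
      split_ifs with hc
      · have h1 := pairW_nonneg (m := d - 1) hc
        have h2 := sumW_nonneg (m := d - 1) hc
        positivity
      · exact le_rfl
    have hmono : stepMean d h (fun h : EdgeHistory n => max ((unsat d h).card - 2 - μ) 0 ^ 2) ≤
        max (((unsat d h).card : ℝ) - 2 - μ) 0 ^ 2 := by
      refine (stepMean_mono_of_nonempty
        (g := fun _ => max (((unsat d h).card : ℝ) - 2 - μ) 0 ^ 2)
        (hr.allowed_nonempty hl') fun e _ => ?_).trans (stepMean_const _ _).le
      rw [card_unsat_eq_lowCount hd, card_unsat_eq_lowCount hd]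
      refine pow_le_pow_left₀ (le_max_right _ _) (max_le_max ?_ le_rfl) 2
      have : (lowCount (d - 1) (h ++ [e]) : ℝ) ≤ lowCount (d - 1) h := by
        exact_mod_cast lowCount_snoc_le (d - 1) h e
      linarith
    refine stepMean_upTo_le hr hl' (fun c => ?_) (fun c1 c2 => ?_) (fun c => ?_)
    · have hδ : (0 : ℝ) ≤ 2 / ((unsat d h).card : ℝ) := by positivity
      rw [upTo_of_le (by linarith)]
      exact stepMean_quadW_le hd hμ hr hl' c
    · refine (hmono.trans ?_).trans (le_add_of_nonneg_right hr0)
      refine le_trans ?_ (sq_sub_le_quadW c1)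
      have hU : (0 : ℝ) < (unsat d h).card := by
        have := hr.two_mul_le_card hl'
        exact_mod_cast (by omega : 0 < (unsat d h).card)
      have hX : ((unsat d h).card : ℝ) - 2 ≤ sumW d (d - 1) a h := by
        refine le_trans ?_ (card_mul_exp_le_sumW c1)
        rw [← card_unsat_eq_lowCount hd]
        have h1 := Real.add_one_le_exp (-(a - clock d h))
        have h2 : 1 - 2 / ((unsat d h).card : ℝ) ≤ Real.exp (-(a - clock d h)) := by linarith
        have h3 := mul_le_mul_of_nonneg_left h2 hU.le
        refine le_trans (le_of_eq ?_) h3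
        field_simp
      rcases le_total (((unsat d h).card : ℝ) - 2 - μ) 0 with h0 | h0
      · rw [max_eq_right h0, zero_pow two_ne_zero]
        exact sq_nonneg _
      · rw [max_eq_left h0]
        exact pow_le_pow_left₀ h0 (by linarith) 2
    · exact hmono.trans (le_add_of_nonneg_right hr0)

end

/-! ### Locating the clock, and the probability that no low vertex remains -/

section
open Classical

variable {d n : ℕ}

theorem runProb_mul_le {T : ℕ} (hT : 2 * d * d + 2 * T ≤ d * n) {p : EdgeHistory n → Prop} {c : ℝ}
    {f : EdgeHistory n → ℝ} (h1 : ∀ h, Reach d h → h.length = T → p h → c ≤ f h)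
    (h0 : ∀ h, Reach d h → h.length = T → 0 ≤ f h) :
    runProb d n T p * c ≤ runMean d n T f := by
  rw [mul_comm, runProb, ← runMean_smul]
  refine runMean_mono T hT fun h hr hl => ?_
  split_ifs with hp
  · rw [mul_one]
    exact h1 h hr hl hp
  · rw [mul_zero]
    exact h0 h hr hl

theorem Reach.card_unsat_le_real {h : EdgeHistory n} (hr : Reach d h) :
    ((unsat d h).card : ℝ) ≤ (d : ℝ) * n - 2 * h.length := by
  have := hr.card_unsat_le
  rw [le_sub_iff_add_le]
  exact_mod_cast this

theorem upTo_quadW_nonneg {a μ : ℝ} (h : EdgeHistory n) :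
    0 ≤ upTo d a (quadW d a μ)
      (fun h : EdgeHistory n => max (((unsat d h).card : ℝ) - 2 - μ) 0 ^ 2) h := by
  unfold upTo
  split_ifs with hc
  · exact (sq_nonneg _).trans (sq_sub_le_quadW hc)
  · exact sq_nonneg _

/-- The clock is not late. -/
theorem runProb_clock_le_mul (hd : 0 < d) {T : ℕ} (hT : 2 * d * d + 2 * T ≤ d * n) {a : ℝ}
    (ha : 0 ≤ a) (hD : (d : ℝ) * n - 2 * T ≤ n * poi d a) :
    runProb d n T (fun h => clock d h ≤ a) * (n * poi d a - ((d : ℝ) * n - 2 * T)) ^ 2 ≤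
      n * poi d a + totalErr d n T * (Real.exp (totalErr d n T) *
        ((n * poi d a) ^ 2 + (2 * (n * poi d a) + 1) * (n * poi d a))) := by
  refine (runProb_mul_le hT (fun h hr hl hp => ?_) fun h _ _ => upTo_quadW_nonneg h).trans
    (runMean_upTo_quadW_le hd hT ha)
  -- Chebyshev: while the clock is at most `a`, the sum of weights is at most `U ≤ d * n - 2 * T`,
  -- which falls short of its typical value `n * poi d a`.
  rw [upTo_of_le hp]
  refine le_trans ?_ (sq_sub_le_quadW hp)
  have h1 := sumW_le_card (m := d - 1) hp
  rw [← card_unsat_eq_lowCount hd] at h1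
  have h2 := hr.card_unsat_le_real
  rw [hl] at h2
  rw [← neg_sq (sumW _ _ _ _ - _), neg_sub]
  exact pow_le_pow_left₀ (by linarith) (by linarith) 2

/-- The clock has not passed `a` while many vertices are unsaturated. -/
theorem runProb_lt_clock_card_mul (hd : 0 < d) {T : ℕ} (hT : 2 * d * d + 2 * T ≤ d * n) {a y : ℝ}
    (ha : 0 ≤ a) (hy : n * poi d a ≤ y - 2) :
    runProb d n T (fun h => a < clock d h ∧ y ≤ (unsat d h).card) * (y - 2 - n * poi d a) ^ 2 ≤
      n * poi d a + totalErr d n T * (Real.exp (totalErr d n T) *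
        ((n * poi d a) ^ 2 + (2 * (n * poi d a) + 1) * (n * poi d a))) := by
  refine (runProb_mul_le hT (fun h hr hl hp => ?_) fun h _ _ => upTo_quadW_nonneg h).trans
    (runMean_upTo_quadW_le hd hT ha)
  rw [upTo_of_lt hp.1]
  refine pow_le_pow_left₀ (by linarith) (le_max_of_le_left ?_) 2
  linarith [hp.2]

/-- When the clock has passed `a`, few unsaturated vertices have degree less than `d - 1`. -/
theorem runProb_lt_clock_card_lt_mul (hd : 2 ≤ d) {T : ℕ} (hT : 2 * d * d + 2 * T ≤ d * n)
    {a y : ℝ} (ha : 0 ≤ a) :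
    runProb d n T (fun h => a < clock d h ∧ ((unsat d h).card : ℝ) < y) *
      ((d : ℝ) * n - 2 * T - y) ≤
      (d * Real.exp 1) * (Real.exp (totalErr d n T) * (n * poi (d - 1) a)) := by
  have hm : d - 2 + 1 = d - 1 := by omega
  have key := runMean_upTo_sumW_le (m := d - 2) (by omega) hT ha T le_rfl
  rw [hm] at key
  refine le_trans ?_ (mul_le_mul_of_nonneg_left key (by positivity))
  rw [← runMean_smul]
  refine runProb_mul_le hT (fun h hr hl hp => ?_) fun h _ _ => ?_
  · rw [upTo_of_lt hp.1]
    -- Fewer than `y` unsaturated vertices can account for the missing half-edges only if many have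
    -- degree at most `d - 2`; Markov's inequality makes this unlikely.
    have h1 : (d * n : ℝ) ≤ (unsat d h).card + d * lowCount (d - 2) h + 2 * T := by
      have h2 := hr.le_card_unsat_add
      have h3 : ({v | hdeg h v + 2 ≤ d} : Finset (Fin n)).card = lowCount (d - 2) h := by
        rw [lowCount]
        congr 1
        ext v
        simp only [Finset.mem_filter, Finset.mem_univ, true_and]
        omega
      rw [h3, hl] at h2
      exact_mod_cast h2
    have h4 : d * Real.exp 1 * (Real.exp (-1) * (lowCount (d - 2) h : ℝ)) =
        d * lowCount (d - 2) h := by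
      have : Real.exp 1 * Real.exp (-1) = 1 := by rw [← Real.exp_add]; simp
      calc _ = d * (Real.exp 1 * Real.exp (-1)) * (lowCount (d - 2) h : ℝ) := by ring
        _ = _ := by rw [this, mul_one]
    rw [h4]
    linarith [hp.2]
  · refine mul_nonneg (by positivity) ?_
    unfold upTo
    split_ifs with hc
    · exact sumW_nonneg hc
    · positivity

theorem lowCount_eq_zero {m : ℕ} {h : EdgeHistory n} :
    lowCount m h = 0 ↔ ∀ v, m < hdeg h v := by
  rw [lowCount, Finset.card_eq_zero, Finset.filter_eq_empty_iff]
  simp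

theorem stepMean_neg (h : EdgeHistory n) (f : EdgeHistory n → ℝ) :
    stepMean d h (fun x => -f x) = -stepMean d h f := by
  have := stepMean_smul (d := d) h (-1) f
  simpa using this

theorem runMean_neg (k : ℕ) (f : EdgeHistory n → ℝ) :
    runMean d n k (fun x => -f x) = -runMean d n k f := by
  have := runMean_smul (d := d) (n := n) k (-1) f
  simpa using this

theorem upTo_weights_nonneg {m : ℕ} {a : ℝ} (h : EdgeHistory n) :
    0 ≤ upTo d a (fun h : EdgeHistory n => pairW d m a h + 1 * sumW d m a h) (fun _ => 0) h := by
  unfold upTo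
  split_ifs with hc
  · simp only [one_mul]
    exact add_nonneg (pairW_nonneg hc) (sumW_nonneg hc)
  · exact le_rfl

/-- If no low vertex is left while the clock is at most `a`, all weights vanish and `prodW` equals
1. Runs whose clock has passed `a` are paid for by the last term. -/
theorem runProb_lowCount_le {T m : ℕ} (hm : m < d) (hT : 2 * d * d + 2 * T ≤ d * n) {a : ℝ}
    (ha : 0 ≤ a) :
    runProb d n T (fun h => lowCount m h = 0) ≤ (1 - poi (m + 1) a) ^ n +
      totalErr d n T * (Real.exp (totalErr d n T) *
        ((n * poi (m + 1) a) ^ 2 + 1 * (n * poi (m + 1) a))) +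
      runProb d n T (fun h => a < clock d h) := by
  have key := runMean_le_of_weight_step hm hT ha zero_le_one
    (f := upTo d a (prodW d m a) (fun _ : EdgeHistory n => 0)) (fun h hr hl => ?_)
  · rw [upTo_of_le (by simpa using ha), prodW_nil] at key
    refine le_trans ?_ (add_le_add_left key _)
    rw [runProb, runProb, ← runMean_add]
    refine runMean_mono T hT fun h _ _ => ?_
    unfold upTo
    by_cases hc : clock d h ≤ a
    · rw [if_pos hc, if_neg (not_lt.2 hc), add_zero]
      split_ifs with hp
      · rw [lowCount_eq_zero] at hp
        refine le_of_eq (Finset.prod_eq_one fun v _ => ?_).symm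
        rw [wt, show m + 1 - hdeg h v = 0 by have := hp v; omega, poi_zero_left, sub_zero]
      · exact prodW_nonneg hc
    · rw [if_neg hc, if_pos (not_le.1 hc), zero_add]
      split_ifs <;> norm_num
  · have hl' : 2 * d * d + 2 * h.length < d * n := by omega
    have hr0 := mul_nonneg (stepErr_nonneg d n h.length) (upTo_weights_nonneg (d := d) (m := m) (a := a) h)
    refine stepMean_upTo_le hr hl' (fun c => ?_) (fun c1 c2 => ?_) (fun c => ?_)
    · have hδ : (0 : ℝ) ≤ 2 / ((unsat d h).card : ℝ) := by positivity
      rw [upTo_of_le (by linarith), one_mul]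
      linarith [(abs_le.1 (stepMean_prodW hm hr hl' c)).2]
    · rw [stepMean_const]
      exact add_nonneg (prodW_nonneg c1) hr0
    · rw [stepMean_const, zero_add]
      exact hr0

/-- Follows `prodW` until the clock crosses `a`. If a low vertex is present then, its weight is at
least `1 - 2 / U`, so `prodW` is at most `2 / U ≤ κ`; otherwise none is present at any later time
either. -/
theorem le_runProb_lowCount {T m : ℕ} (hm : m < d) (hT : 2 * d * d + 2 * T ≤ d * n) {a : ℝ}
    (ha : 0 ≤ a) :
    (1 - poi (m + 1) a) ^ n ≤ runProb d n T (fun h => lowCount m h = 0) +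
      totalErr d n T * (Real.exp (totalErr d n T) *
        ((n * poi (m + 1) a) ^ 2 + 1 * (n * poi (m + 1) a))) +
      2 * d / ((d : ℝ) * n - 2 * T) + runProb d n T (fun h => clock d h ≤ a) := by
  have hT' : (2 * d * d + 2 * T : ℝ) ≤ d * n := by exact_mod_cast hT
  have hd0 : (1 : ℝ) ≤ d := by exact_mod_cast (by omega : 1 ≤ d)
  have hD : 0 < (d : ℝ) * n - 2 * T := by nlinarith
  set κ : ℝ := 2 * d / ((d : ℝ) * n - 2 * T)
  have hκ : 0 ≤ κ := by positivity
  have key := runMean_le_of_weight_step hm hT ha zero_le_one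
    (f := upTo d a (fun h => -prodW d m a h)
      (fun h : EdgeHistory n => -((if lowCount m h = 0 then 1 else 0) + κ))) (fun h hr hl => ?_)
  · rw [upTo_of_le (by simpa using ha), prodW_nil] at key
    have h2 : -(runProb d n T (fun h => lowCount m h = 0) + κ +
        runProb d n T (fun h => clock d h ≤ a)) ≤ runMean d n T (upTo d a (fun h => -prodW d m a h)
      (fun h : EdgeHistory n => -((if lowCount m h = 0 then 1 else 0) + κ))) := by
      have e : runProb d n T (fun h => lowCount m h = 0) + κ +
          runProb d n T (fun h => clock d h ≤ a) = runMean d n T (fun h =>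
            (if lowCount m h = 0 then 1 else 0) + κ + if clock d h ≤ a then 1 else 0) := by
        rw [runMean_add, runMean_add, runMean_const]
        unfold runProb
        congr!
      rw [e, ← runMean_neg]
      refine runMean_mono T hT fun h _ _ => ?_
      unfold upTo
      by_cases h2 : clock d h ≤ a
      · simp only [if_pos h2]
        have h3 : (0 : ℝ) ≤ if lowCount m h = 0 then 1 else 0 := by split_ifs <;> norm_num
        linarith [prodW_le_one (m := m) h2]
      · simp only [if_neg h2]
        linarith
    linarith
  · have hl' : 2 * d * d + 2 * h.length < d * n := by omega
    have hr0 := mul_nonneg (stepErr_nonneg d n h.length) (upTo_weights_nonneg (d := d) (m := m) (a := a) h)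
    have hmono : stepMean d h (fun h : EdgeHistory n =>
          -((if lowCount m h = 0 then (1 : ℝ) else 0) + κ)) ≤
        -((if lowCount m h = 0 then 1 else 0) + κ) := by
      refine (stepMean_mono_of_nonempty
        (g := fun _ => -((if lowCount m h = 0 then (1 : ℝ) else 0) + κ))
        (hr.allowed_nonempty hl') fun e _ => ?_).trans (stepMean_const _ _).le
      have h1 := lowCount_snoc_le m h e
      by_cases h2 : lowCount m h = 0
      · rw [if_pos h2, if_pos (by omega)]
      · rw [if_neg h2]
        split_ifs <;> linarith
    refine stepMean_upTo_le hr hl' (fun c => ?_) (fun c1 c2 => ?_) (fun c => ?_)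
    · have hδ : (0 : ℝ) ≤ 2 / ((unsat d h).card : ℝ) := by positivity
      rw [upTo_of_le (by linarith), one_mul, stepMean_neg]
      linarith [(abs_le.1 (stepMean_prodW hm hr hl' c)).1]
    · refine (hmono.trans ?_).trans (le_add_of_nonneg_right hr0)
      rw [neg_le_neg_iff]
      split_ifs with hp
      · linarith [prodW_le_one (m := m) c1]
      · rw [lowCount_eq_zero] at hp
        push Not at hp
        obtain ⟨v, hv⟩ := hp
        have h1 : prodW d m a h ≤ 1 - wt d m a h v := by
          rw [prodW, ← Finset.mul_prod_erase _ _ (Finset.mem_univ v)]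
          refine mul_le_of_le_one_right (sub_nonneg.2 (wt_le_one c1 v)) ?_
          exact Finset.prod_le_one (fun v _ => sub_nonneg.2 (wt_le_one c1 v))
            fun v _ => by linarith [wt_nonneg (m := m) c1 v]
        have h2 : 1 - (a - clock d h) ≤ wt d m a h v := by
          rw [wt, Nat.succ_sub hv]
          refine le_trans ?_ (exp_neg_le_poi _ (by linarith))
          linarith [Real.add_one_le_exp (-(a - clock d h))]
        have h3 : 2 / ((unsat d h).card : ℝ) ≤ κ := by
          have hU : (0 : ℝ) < (unsat d h).card := by
            have := hr.two_mul_le_card hl'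
            exact_mod_cast (by omega : 0 < (unsat d h).card)
          have h4 : (d * n : ℝ) ≤ d * (unsat d h).card + 2 * h.length := by
            exact_mod_cast hr.le_card_unsat
          have h5 : (h.length : ℝ) ≤ T := by exact_mod_cast hl.le
          rw [div_le_div_iff₀ hU hD]
          linarith
        linarith
    · exact hmono.trans (le_add_of_nonneg_right hr0)

end

/-! ### From the last time of low minimum degree to the graph after `T` edges -/

section
open Classical

variable {d n : ℕ}

theorem stepMean_eq_self {h : EdgeHistory n} {f : EdgeHistory n → ℝ}
    (hf : ∀ e ∈ allowedPairs d (graphAt h h.length), f (h ++ [e]) = f h) :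
    stepMean d h f = f h := by
  unfold stepMean
  split_ifs with hne
  · have : ((allowedPairs d (graphAt h h.length)).card : ℝ) ≠ 0 := by
      exact_mod_cast hne.card_pos.ne'
    rw [Finset.sum_congr rfl hf, Finset.sum_const, nsmul_eq_mul, mul_div_cancel_left₀ _ this]
  · rfl

/-- The mean of a function of the first `T` edges is the same at all later times. -/
theorem runMean_eq_of_stable {T : ℕ} (hT : 2 * d * d + 2 * T ≤ d * n) {f : EdgeHistory n → ℝ}
    (hf : ∀ h e, T ≤ h.length → f (h ++ [e]) = f h) (k : ℕ) (hk : T ≤ k) :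
    runMean d n k f = runMean d n T f := by
  induction k, hk using Nat.le_induction with
  | base => rfl
  | succ k hk ih =>
    rw [← ih]
    refine le_antisymm ?_ ?_
    · exact runMean_mono_of_le hT k hk fun h _ hl => (stepMean_eq_self fun e _ => hf h e hl).le
    · exact runMean_mono_of_le hT k hk fun h _ hl => (stepMean_eq_self fun e _ => hf h e hl).ge

theorem hdeg_take_le_hdeg_take (h : EdgeHistory n) {s s' : ℕ} (hs : s ≤ s') (v : Fin n) :
    hdeg (h.take s) v ≤ hdeg (h.take s') v := by
  rw [← min_eq_left hs, ← List.take_take]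
  exact (List.take_sublist _ _).countP_le

theorem lt_minDegree_iff {h : EdgeHistory n} (hn : 0 < n) (hr : Reach d h) (s j : ℕ) :
    j < (graphAt h s).minDegree ↔ lowCount j (h.take s) = 0 := by
  have : Nonempty (Fin n) := ⟨⟨0, hn⟩⟩
  rw [lowCount_eq_zero]
  constructor
  · intro hj v
    rw [← degree_graphAt hr.wf.1 hr.wf.2.1 s v]
    exact hj.trans_le ((graphAt h s).minDegree_le_degree v)
  · intro hv
    obtain ⟨v, hv'⟩ := (graphAt h s).exists_minimal_degree_vertex
    rw [hv', degree_graphAt hr.wf.1 hr.wf.2.1 s v]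
    exact hv v

theorem lowCount_take_eq_zero_mono {j : ℕ} (h : EdgeHistory n) {s s' : ℕ} (hs : s ≤ s')
    (h0 : lowCount j (h.take s) = 0) : lowCount j (h.take s') = 0 := by
  rw [lowCount_eq_zero] at h0 ⊢
  exact fun v => (h0 v).trans_le (hdeg_take_le_hdeg_take h hs v)

theorem lastTime_lt_iff {h : EdgeHistory n} (hn : 0 < n) (hr : Reach d h) {T j : ℕ}
    (hl : T ≤ h.length) : lastTime j h < T ↔ lowCount j (h.take T) = 0 := by
  have hset : {s | s ≤ h.length ∧ (graphAt h s).minDegree ≤ j} =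
      {s | s ≤ h.length ∧ lowCount j (h.take s) ≠ 0} := by
    ext s
    simp only [Set.mem_ofPred_eq, ← not_lt, ne_eq, ← lt_minDegree_iff hn hr]
  have hbdd : BddAbove {s | s ≤ h.length ∧ lowCount j (h.take s) ≠ 0} :=
    ⟨h.length, fun s hs => hs.1⟩
  have h0 : (0 : ℕ) ∈ {s | s ≤ h.length ∧ lowCount j (h.take s) ≠ 0} := by
    refine ⟨Nat.zero_le _, fun hc => ?_⟩
    rw [lowCount_eq_zero] at hc
    have := hc ⟨0, hn⟩
    simp at this
  have e : lastTime j h = sSup {s | s ≤ h.length ∧ lowCount j (h.take s) ≠ 0} := by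
    rw [← hset, lastTime]
  rw [e]
  constructor
  · intro hlt
    by_contra hc
    exact absurd (le_csSup hbdd ⟨hl, hc⟩) (not_le.2 hlt)
  · intro hT
    have hmem := Nat.sSup_mem ⟨0, h0⟩ hbdd
    by_contra! hc
    exact hmem.2 (lowCount_take_eq_zero_mono h hc hT)

/-- The number of edges of the graph when `t` edges are missing. -/
noncomputable def edgesAt (d n : ℕ) (t : ℝ) : ℕ := d * n / 2 - ⌊t⌋₊

theorem lt_sub_iff_lt_edgesAt {s : ℕ} {t : ℝ} (ht : 0 ≤ t) :
    (s : ℝ) < ((d * n / 2 : ℕ) : ℝ) - t ↔ s < edgesAt d n t := by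
  rw [edgesAt, Nat.lt_sub_iff_add_lt, lt_sub_iff_add_lt]
  constructor
  · intro h
    have h1 := Nat.floor_le ht
    have : ((s + ⌊t⌋₊ : ℕ) : ℝ) < ((d * n / 2 : ℕ) : ℝ) := by
      push_cast
      linarith
    exact_mod_cast this
  · intro h
    have h1 := Nat.lt_floor_add_one t
    have : ((s + ⌊t⌋₊ + 1 : ℕ) : ℝ) ≤ ((d * n / 2 : ℕ) : ℝ) := by exact_mod_cast h
    push_cast at this
    linarith

/-- Degrees only grow, so the event says that the graph after `T = edgesAt d n t` edges has no low
vertex. That graph exists because the process is not stuck before `T`, and it is unaffected by the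
later steps. -/
theorem dProb_lastTime_lt (hn : 0 < n) {j : ℕ} {t : ℝ} (ht : 0 ≤ t)
    (hT : 2 * d * d + 2 * edgesAt d n t ≤ d * n) :
    dProb d n {h | (lastTime j h : ℝ) < ((d * n / 2 : ℕ) : ℝ) - t} =
      runProb d n (edgesAt d n t) (fun h => lowCount j h = 0) := by
  set T := edgesAt d n t with hTdef
  have hTN : T ≤ d * n / 2 := Nat.sub_le _ _
  rw [dProb_eq_runMean]
  have h1 : runMean d n (d * n / 2) (Set.indicator
      {h | (lastTime j h : ℝ) < ((d * n / 2 : ℕ) : ℝ) - t} 1) =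
      runMean d n (d * n / 2) (fun h => if lowCount j (h.take T) = 0 then 1 else 0) := by
    have hpt : ∀ h : EdgeHistory n, Reach d h → T ≤ h.length → Set.indicator
        {h : EdgeHistory n | (lastTime j h : ℝ) < ((d * n / 2 : ℕ) : ℝ) - t} (1 : EdgeHistory n → ℝ) h =
        if lowCount j (h.take T) = 0 then 1 else 0 := by
      intro h hr hl
      have hiff : h ∈ {h : EdgeHistory n | (lastTime j h : ℝ) < ((d * n / 2 : ℕ) : ℝ) - t} ↔
          lowCount j (h.take T) = 0 := by
        rw [Set.mem_ofPred_eq, lt_sub_iff_lt_edgesAt ht, ← hTdef, lastTime_lt_iff hn hr hl]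
      by_cases hc : lowCount j (h.take T) = 0
      · rw [if_pos hc, Set.indicator_of_mem (hiff.2 hc), Pi.one_apply]
      · rw [if_neg hc, Set.indicator_of_notMem (hiff.not.2 hc)]
    exact le_antisymm
      (runMean_mono_of_le hT _ hTN fun h hr hl => (hpt h hr hl).le)
      (runMean_mono_of_le hT _ hTN fun h hr hl => (hpt h hr hl).ge)
  rw [h1, runMean_eq_of_stable hT (fun h e hl => by
    rw [List.take_append_of_le_length hl]) _ hTN, runProb]
  refine le_antisymm ?_ ?_ <;> refine runMean_mono T hT fun h _ hl => ?_ <;>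
  · rw [← hl, List.take_length]
    exact le_of_eq (by congr!)

end

/-! ### Asymptotics at the critical time -/

section

theorem tendsto_log_nat : Tendsto (fun n : ℕ => Real.log n) atTop atTop :=
  Real.tendsto_log_atTop.comp tendsto_natCast_atTop_atTop

theorem tendsto_one_div_log_pow {p : ℕ} (hp : 0 < p) :
    Tendsto (fun n : ℕ => 1 / Real.log n ^ p) atTop (𝓝 0) := by
  have h := tendsto_inv_atTop_zero.comp ((tendsto_pow_atTop hp.ne').comp tendsto_log_nat)
  simpa [Function.comp_def] using h

theorem eventually_log_pos : ∀ᶠ n : ℕ in atTop, 0 < Real.log n :=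
  tendsto_log_nat.eventually_gt_atTop 0

theorem eventually_mul_log_pow_le (c : ℝ) (p : ℕ) :
    ∀ᶠ n : ℕ in atTop, c * Real.log n ^ p ≤ n := by
  have h1 := ((Real.isLittleO_pow_log_id_atTop (n := p)).const_mul_left c).bound one_pos
  have h2 := tendsto_natCast_atTop_atTop (R := ℝ).eventually h1
  filter_upwards [h2] with n hn
  simp only [Real.norm_eq_abs, id, one_mul, Nat.abs_cast] at hn
  exact (le_abs_self _).trans hn

/-- The number of half-edges missing when `t` edges are missing. -/
noncomputable def missing (d n : ℕ) (t : ℝ) : ℝ := (d : ℝ) * n - 2 * edgesAt d n t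

theorem abs_missing_sub_le {d n : ℕ} {t : ℝ} (hd : 2 ≤ d) (ht : 0 ≤ t) (htn : t ≤ n) :
    |missing d n t - 2 * t| ≤ 2 := by
  -- Makes the truncated subtraction in `edgesAt` exact; the remaining error of at most 2 comes from
  -- the floor and the parity of `d * n`.
  have h1 : ⌊t⌋₊ ≤ d * n / 2 := by
    have h2 : ⌊t⌋₊ ≤ n := Nat.floor_le_of_le htn
    have h3 : n ≤ d * n / 2 := by
      rw [Nat.le_div_iff_mul_le two_pos, mul_comm]
      exact Nat.mul_le_mul_right n hd
    exact h2.trans h3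
  have h4 : d * n = 2 * edgesAt d n t + 2 * ⌊t⌋₊ + d * n % 2 := by
    unfold edgesAt
    omega
  have h5 : d * n % 2 ≤ 1 := by omega
  have h5' : ((d * n % 2 : ℕ) : ℝ) ≤ 1 := by exact_mod_cast h5
  have h5'' : (0 : ℝ) ≤ ((d * n % 2 : ℕ) : ℝ) := Nat.cast_nonneg _
  have h6 : (d : ℝ) * n = 2 * edgesAt d n t + 2 * ⌊t⌋₊ + ((d * n % 2 : ℕ) : ℝ) := by
    exact_mod_cast h4
  have h7 := Nat.floor_le ht
  have h8 := Nat.lt_floor_add_one t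
  rw [missing, h6, abs_le]
  constructor <;> linarith

theorem tendsto_missing_div {d p : ℕ} (hd : 2 ≤ d) (hp : 0 < p) {c : ℝ} (hc : 0 < c) :
    Tendsto (fun n : ℕ => missing d n (c * Real.log n ^ p) / Real.log n ^ p) atTop (𝓝 (2 * c)) := by
  rw [tendsto_iff_dist_tendsto_zero]
  have h0 := (tendsto_one_div_log_pow hp).const_mul 2
  rw [mul_zero] at h0
  refine squeeze_zero' (Eventually.of_forall fun n => dist_nonneg) ?_ h0
  filter_upwards [eventually_log_pos, eventually_mul_log_pow_le c p] with n hn1 hn2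
  have hL : 0 < Real.log n ^ p := pow_pos hn1 p
  have h1 := abs_missing_sub_le hd (by positivity) hn2
  have e : missing d n (c * Real.log n ^ p) / Real.log n ^ p - 2 * c =
      (missing d n (c * Real.log n ^ p) - 2 * (c * Real.log n ^ p)) * (1 / Real.log n ^ p) := by
    field_simp
  rw [Real.dist_eq, e, abs_mul, abs_of_pos (by positivity : 0 < 1 / Real.log n ^ p)]
  gcongr

theorem tendsto_missing {d p : ℕ} (hd : 2 ≤ d) (hp : 0 < p) {c : ℝ} (hc : 0 < c) :
    Tendsto (fun n : ℕ => missing d n (c * Real.log n ^ p)) atTop atTop := by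
  have h1 : Tendsto (fun n : ℕ => Real.log n ^ p) atTop atTop :=
    (tendsto_pow_atTop hp.ne').comp tendsto_log_nat
  refine ((tendsto_missing_div hd hp hc).pos_mul_atTop (by positivity) h1).congr' ?_
  filter_upwards [eventually_log_pos] with n hn
  exact div_mul_cancel₀ _ (pow_pos hn p).ne'

theorem eventually_edgesAt_le {d p : ℕ} (hd : 2 ≤ d) (hp : 0 < p) {c : ℝ} (hc : 0 < c) :
    ∀ᶠ n : ℕ in atTop, 2 * d * d + 2 * edgesAt d n (c * Real.log n ^ p) ≤ d * n := by
  filter_upwards [(tendsto_missing hd hp hc).eventually_ge_atTop (2 * d * d : ℝ)] with n hn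
  rw [missing, le_sub_iff_add_le] at hn
  exact_mod_cast hn

theorem tendsto_totalErr {d p : ℕ} (hd : 2 ≤ d) (hp : 0 < p) {c : ℝ} (hc : 0 < c) :
    Tendsto (fun n : ℕ => totalErr d n (edgesAt d n (c * Real.log n ^ p))) atTop (𝓝 0) :=
  (tendsto_missing hd hp hc).const_div_atTop _

/-- The clock time at which about `κ / j!` vertices have degree at most `j`. -/
noncomputable def critTime (j : ℕ) (κ : ℝ) (n : ℕ) : ℝ :=
  Real.log n + j * Real.log (Real.log n) - Real.log κ

theorem tendsto_critTime_div (j : ℕ) (κ : ℝ) :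
    Tendsto (fun n : ℕ => critTime j κ n / Real.log n) atTop (𝓝 1) := by
  have h1 : Tendsto (fun n : ℕ => Real.log (Real.log n) / Real.log n) atTop (𝓝 0) :=
    (Real.isLittleO_log_id_atTop.tendsto_div_nhds_zero).comp tendsto_log_nat
  have h2 := tendsto_one_div_log_pow one_pos
  have h3 := ((h1.const_mul (j : ℝ)).const_add 1).sub (h2.const_mul (Real.log κ))
  simp only [mul_zero, add_zero, sub_zero] at h3
  refine h3.congr' ?_
  filter_upwards [eventually_log_pos] with n hn
  rw [critTime]
  field_simp

theorem eventually_critTime_nonneg (j : ℕ) (κ : ℝ) : ∀ᶠ n : ℕ in atTop, 0 ≤ critTime j κ n := by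
  filter_upwards [eventually_log_pos,
    (tendsto_critTime_div j κ).eventually (lt_mem_nhds zero_lt_one)] with n h1 h2
  exact ((div_pos_iff_of_pos_right h1).1 h2).le

theorem mul_exp_neg_critTime {j : ℕ} {κ : ℝ} (hκ : 0 < κ) {n : ℕ} (hn : 0 < Real.log n) :
    n * Real.exp (-critTime j κ n) = κ / Real.log n ^ j := by
  have hn0 : (0 : ℝ) < n := by
    rcases Nat.eq_zero_or_pos n with rfl | h
    · simp at hn
    · exact_mod_cast h
  have e : -critTime j κ n = Real.log κ - Real.log n - j * Real.log (Real.log n) := by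
    unfold critTime
    ring
  rw [e, Real.exp_sub, Real.exp_sub, Real.exp_log hκ, Real.exp_log hn0, ← Real.log_pow,
    Real.exp_log (pow_pos hn j)]
  field_simp

/-- Since `critTime` is asymptotic to `log n`, only the top term `i = m` of the Poisson sum
survives, and `n * exp (-critTime)` is exactly `κ / log ^ j n`. -/
theorem tendsto_mul_poi_critTime (m : ℕ) {j : ℕ} {κ : ℝ} (hκ : 0 < κ) :
    Tendsto (fun n : ℕ => n * poi (m + 1) (critTime j κ n) * Real.log n ^ j / Real.log n ^ m)
      atTop (𝓝 (κ / m.factorial)) := by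
  have h1 := tendsto_critTime_div j κ
  have hterm : ∀ i ∈ Finset.range (m + 1), Tendsto (fun n : ℕ =>
      critTime j κ n ^ i / (i.factorial : ℝ) / Real.log n ^ m) atTop
      (𝓝 (if i = m then 1 / (m.factorial : ℝ) else 0)) := by
    intro i hi
    have h2 : Tendsto (fun n : ℕ => (critTime j κ n / Real.log n) ^ i / (i.factorial : ℝ) *
        (1 / Real.log n ^ (m - i))) atTop (𝓝 (if i = m then 1 / (m.factorial : ℝ) else 0)) := by
      have h3 := (h1.pow i).div_const (i.factorial : ℝ)
      rw [one_pow] at h3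
      split_ifs with him
      · subst him
        simpa using h3
      · have : 0 < m - i := by
          have := Finset.mem_range.1 hi
          omega
        simpa using h3.mul (tendsto_one_div_log_pow this)
    refine h2.congr' ?_
    filter_upwards [eventually_log_pos] with n hn
    have him : m = i + (m - i) := by
      have := Finset.mem_range.1 hi
      omega
    have e : Real.log n ^ m = Real.log n ^ i * Real.log n ^ (m - i) := by rw [← pow_add, ← him]
    rw [e, div_pow]
    field_simp
  have hsum := (tendsto_finsetSum _ hterm).const_mul κ
  rw [Finset.sum_ite_eq' , if_pos (Finset.self_mem_range_succ m), mul_one_div] at hsum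
  refine hsum.congr' ?_
  filter_upwards [eventually_log_pos] with n hn
  rw [poi, ← mul_assoc, mul_exp_neg_critTime hκ hn, ← Finset.sum_div]
  have := pow_pos hn j
  field_simp

theorem tendsto_mul_poi_top {d j : ℕ} (hj : j + 1 < d) {κ : ℝ} (hκ : 0 < κ) :
    Tendsto (fun n : ℕ => n * poi d (critTime j κ n) / Real.log n ^ (d - 1 - j))
      atTop (𝓝 (κ / (d - 1).factorial)) := by
  refine (tendsto_mul_poi_critTime (d - 1) (j := j) hκ).congr' ?_
  filter_upwards [eventually_log_pos] with n hn
  have e1 : d - 1 + 1 = d := by omega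
  have e : Real.log n ^ (d - 1) = Real.log n ^ (d - 1 - j) * Real.log n ^ j := by
    rw [← pow_add]
    congr 1
    omega
  have := pow_pos hn j
  rw [e1, e]
  field_simp

theorem tendsto_mul_poi_sub {d j : ℕ} (hj : j + 1 < d) {κ : ℝ} (hκ : 0 < κ) :
    Tendsto (fun n : ℕ => n * poi (d - 1) (critTime j κ n) / Real.log n ^ (d - 1 - j))
      atTop (𝓝 0) := by
  have h := (tendsto_mul_poi_critTime (d - 2) (j := j) hκ).mul (tendsto_one_div_log_pow one_pos)
  rw [mul_zero] at h
  refine h.congr' ?_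
  filter_upwards [eventually_log_pos] with n hn
  have e1 : d - 2 + 1 = d - 1 := by omega
  have e : Real.log n ^ (d - 2) * Real.log n = Real.log n ^ (d - 1 - j) * Real.log n ^ j := by
    rw [← pow_add, ← pow_succ]
    congr 1
    omega
  have := pow_pos hn j
  have := pow_pos hn (d - 2)
  rw [e1, pow_one, div_mul_div_comm, e]
  field_simp

theorem tendsto_mul_poi_low {j : ℕ} {κ : ℝ} (hκ : 0 < κ) :
    Tendsto (fun n : ℕ => n * poi (j + 1) (critTime j κ n)) atTop (𝓝 (κ / j.factorial)) := by
  refine (tendsto_mul_poi_critTime j (j := j) hκ).congr' ?_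
  filter_upwards [eventually_log_pos] with n hn
  have := pow_pos hn j
  field_simp

end

/-! ### The limit law on the scale of powers of the logarithm -/

section
open Classical

theorem runProb_nonneg {d n : ℕ} (k : ℕ) (p : EdgeHistory n → Prop) : 0 ≤ runProb d n k p :=
  runMean_nonneg k fun h => by split_ifs <;> norm_num

theorem le_div_of_mul_scale_le {P x y L E : ℝ} (hL : 0 < L) (hxy : x / L - y / L ≠ 0)
    (h : P * (x - y) ^ 2 ≤ E) : P ≤ E / L ^ 2 / (x / L - y / L) ^ 2 := by
  have h1 : 0 < (x / L - y / L) ^ 2 := by positivity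
  rw [le_div_iff₀ h1, ← sub_div, div_pow, mul_div_assoc']
  gcongr

/-- With `μ` at most of order `L`, the variance bound is `O(L) + o(L ^ 2)`, so Chebyshev at distance
of order `L` gives a vanishing probability. -/
theorem tendsto_quad_bound {μ η L : ℕ → ℝ} {x₀ : ℝ} (hL : ∀ᶠ n in atTop, 0 < L n)
    (hLinv : Tendsto (fun n => 1 / L n) atTop (𝓝 0))
    (hμ : Tendsto (fun n => μ n / L n) atTop (𝓝 x₀)) (hη : Tendsto η atTop (𝓝 0)) :
    Tendsto (fun n => (μ n + η n * (Real.exp (η n) * (μ n ^ 2 + (2 * μ n + 1) * μ n))) / L n ^ 2)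
      atTop (𝓝 0) := by
  have h1 := (hμ.mul hLinv).add (hη.mul (((Real.continuous_exp.tendsto 0).comp hη).mul
    ((hμ.pow 2).add (((hμ.const_mul 2).add hLinv).mul hμ))))
  simp only [mul_zero, zero_mul, add_zero] at h1
  refine h1.congr' ?_
  filter_upwards [hL] with n hn
  simp only [Function.comp]
  field_simp

variable {d j : ℕ}

theorem tendsto_log_pow_inv (hj : j + 1 < d) :
    Tendsto (fun n : ℕ => 1 / Real.log n ^ (d - 1 - j)) atTop (𝓝 0) :=
  tendsto_one_div_log_pow (by omega)

theorem tendsto_quad_bound_critTime (hj : j + 1 < d) {c κ : ℝ} (hc : 0 < c) (hκ : 0 < κ) :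
    Tendsto (fun n : ℕ => (n * poi d (critTime j κ n) +
      totalErr d n (edgesAt d n (c * Real.log n ^ (d - 1 - j))) *
      (Real.exp (totalErr d n (edgesAt d n (c * Real.log n ^ (d - 1 - j)))) *
        ((n * poi d (critTime j κ n)) ^ 2 + (2 * (n * poi d (critTime j κ n)) + 1) *
          (n * poi d (critTime j κ n))))) / (Real.log n ^ (d - 1 - j)) ^ 2) atTop (𝓝 0) :=
  tendsto_quad_bound (eventually_log_pos.mono fun n hn => pow_pos hn _) (tendsto_log_pow_inv hj)
    (tendsto_mul_poi_top hj hκ) (tendsto_totalErr (by omega) (by omega) hc)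

/-- The clock is past the critical time when `c log ^ (d - 1 - j) n` edges are missing. -/
theorem tendsto_runProb_clock_le (hj : j + 1 < d) {c κ : ℝ} (hc : 0 < c) (hκ : 0 < κ)
    (hcκ : 2 * c < κ / (d - 1).factorial) :
    Tendsto (fun n : ℕ => runProb d n (edgesAt d n (c * Real.log n ^ (d - 1 - j)))
      (fun h => clock d h ≤ critTime j κ n)) atTop (𝓝 0) := by
  have h1 := tendsto_mul_poi_top hj hκ
  have h2 := tendsto_missing_div (d := d) (p := d - 1 - j) (by omega) (by omega) hc
  have h3 := h1.sub h2
  have hlim := (tendsto_quad_bound_critTime hj hc hκ).div (h3.pow 2)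
    (pow_ne_zero 2 (sub_pos.2 hcκ).ne')
  rw [zero_div] at hlim
  refine squeeze_zero' (Eventually.of_forall fun n => runProb_nonneg _ _) ?_ hlim
  filter_upwards [eventually_log_pos, eventually_critTime_nonneg j κ,
    eventually_edgesAt_le (d := d) (p := d - 1 - j) (by omega) (by omega) hc,
    h3.eventually (lt_mem_nhds (sub_pos.2 hcκ))] with n hL ha hT hpos
  have hL' := pow_pos hL (d - 1 - j)
  refine le_div_of_mul_scale_le hL' hpos.ne' ?_
  rw [← sub_div, div_pos_iff_of_pos_right hL', sub_pos] at hpos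
  exact runProb_clock_le_mul (by omega) hT ha hpos.le

/-- The clock has not reached the critical time when `c log ^ (d - 1 - j) n` edges are missing. -/
theorem tendsto_runProb_lt_clock (hj : j + 1 < d) {c κ : ℝ} (hc : 0 < c) (hκ : 0 < κ)
    (hcκ : κ / (d - 1).factorial < 2 * c) :
    Tendsto (fun n : ℕ => runProb d n (edgesAt d n (c * Real.log n ^ (d - 1 - j)))
      (fun h => critTime j κ n < clock d h)) atTop (𝓝 0) := by
  -- The threshold `b` splits the event. With at least `b * log ^ (d-1-j) n` unsaturated vertices,
  -- the variance bound applies; with fewer, too many vertices would have degree at most `d - 2`.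
  obtain ⟨b, hb1, hb2⟩ := exists_between hcκ
  have hb0 : 0 < b := lt_trans (by positivity) hb1
  have h1 := tendsto_mul_poi_top hj hκ
  have h2 := tendsto_missing_div (d := d) (p := d - 1 - j) (by omega) (by omega) hc
  have hinv := tendsto_log_pow_inv hj
  have hη := tendsto_totalErr (d := d) (p := d - 1 - j) (by omega) (by omega) hc
  have h3 : Tendsto (fun n : ℕ => (b * Real.log n ^ (d - 1 - j) - 2) / Real.log n ^ (d - 1 - j) -
      n * poi d (critTime j κ n) / Real.log n ^ (d - 1 - j)) atTop
      (𝓝 (b - κ / (d - 1).factorial)) := by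
    have h4 := ((hinv.const_mul 2).const_sub b).sub h1
    rw [mul_zero, sub_zero] at h4
    refine h4.congr' ?_
    filter_upwards [eventually_log_pos] with n hL
    have hL' := pow_pos hL (d - 1 - j)
    field_simp
  have hlim1 := (tendsto_quad_bound_critTime hj hc hκ).div (h3.pow 2)
    (pow_ne_zero 2 (sub_pos.2 hb1).ne')
  have hlim2 := ((((Real.continuous_exp.tendsto 0).comp hη).mul
    (tendsto_mul_poi_sub hj hκ)).const_mul (d * Real.exp 1)).div (h2.sub_const b)
      (sub_pos.2 hb2).ne'
  rw [mul_zero, mul_zero, zero_div] at hlim2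
  rw [zero_div] at hlim1
  have hlim := hlim1.add hlim2
  rw [add_zero] at hlim
  refine squeeze_zero' (Eventually.of_forall fun n => runProb_nonneg _ _) ?_ hlim
  filter_upwards [eventually_log_pos, eventually_critTime_nonneg j κ,
    eventually_edgesAt_le (d := d) (p := d - 1 - j) (by omega) (by omega) hc,
    h3.eventually (lt_mem_nhds (sub_pos.2 hb1)),
    (h2.sub_const b).eventually (lt_mem_nhds (sub_pos.2 hb2))] with n hL ha hT hpos hpos2
  have hL' := pow_pos hL (d - 1 - j)
  have hsplit : runProb d n (edgesAt d n (c * Real.log n ^ (d - 1 - j)))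
      (fun h => critTime j κ n < clock d h) ≤
      runProb d n (edgesAt d n (c * Real.log n ^ (d - 1 - j)))
        (fun h => critTime j κ n < clock d h ∧ b * Real.log n ^ (d - 1 - j) ≤ (unsat d h).card) +
      runProb d n (edgesAt d n (c * Real.log n ^ (d - 1 - j)))
        (fun h => critTime j κ n < clock d h ∧
          ((unsat d h).card : ℝ) < b * Real.log n ^ (d - 1 - j)) := by
    rw [runProb, runProb, runProb, ← runMean_add]
    refine runMean_mono _ hT fun h _ _ => ?_
    by_cases p1 : critTime j κ n < clock d h
    · rcases le_or_gt (b * Real.log n ^ (d - 1 - j)) ((unsat d h).card : ℝ) with p2 | p2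
      · rw [if_pos p1, if_pos ⟨p1, p2⟩]
        refine le_add_of_nonneg_right ?_
        split_ifs <;> norm_num
      · rw [if_pos p1, if_pos (c := _ ∧ _ < _) ⟨p1, p2⟩]
        refine le_add_of_nonneg_left ?_
        split_ifs <;> norm_num
    · simp [p1]
  refine hsplit.trans (add_le_add ?_ ?_)
  · refine le_div_of_mul_scale_le hL' hpos.ne' ?_
    rw [← sub_div, div_pos_iff_of_pos_right hL', sub_pos] at hpos
    exact runProb_lt_clock_card_mul (by omega) hT ha hpos.le
  · have key := runProb_lt_clock_card_lt_mul (by omega) hT (y := b * Real.log n ^ (d - 1 - j)) ha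
    have e : missing d n (c * Real.log n ^ (d - 1 - j)) / Real.log n ^ (d - 1 - j) - b =
        ((d : ℝ) * n - 2 * edgesAt d n (c * Real.log n ^ (d - 1 - j)) -
          b * Real.log n ^ (d - 1 - j)) / Real.log n ^ (d - 1 - j) := by
      rw [missing]
      field_simp
    simp only [Function.comp, Pi.div_apply]
    rw [le_div_iff₀ hpos2, e, mul_div_assoc', mul_div_assoc', mul_div_assoc']
    gcongr

theorem tendsto_low_bound (hj : j + 1 < d) {c κ : ℝ} (hc : 0 < c) (hκ : 0 < κ) :
    Tendsto (fun n : ℕ => totalErr d n (edgesAt d n (c * Real.log n ^ (d - 1 - j))) *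
      (Real.exp (totalErr d n (edgesAt d n (c * Real.log n ^ (d - 1 - j)))) *
        ((n * poi (j + 1) (critTime j κ n)) ^ 2 + 1 * (n * poi (j + 1) (critTime j κ n)))))
      atTop (𝓝 0) := by
  have hη := tendsto_totalErr (d := d) (p := d - 1 - j) (by omega) (by omega) hc
  have hν := tendsto_mul_poi_low (j := j) hκ
  have h := hη.mul (((Real.continuous_exp.tendsto 0).comp hη).mul
    ((hν.pow 2).add (hν.const_mul 1)))
  rw [zero_mul] at h
  exact h

theorem tendsto_one_sub_poi_pow {κ : ℝ} (hκ : 0 < κ) :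
    Tendsto (fun n : ℕ => (1 - poi (j + 1) (critTime j κ n)) ^ n) atTop
      (𝓝 (Real.exp (-(κ / j.factorial)))) := by
  simp_rw [sub_eq_add_neg]
  refine Real.tendsto_one_add_pow_exp_of_tendsto ?_
  have := (tendsto_mul_poi_low (j := j) hκ).neg
  simpa only [mul_neg] using this

/-- The limit law for a fixed multiple of `log ^ (d - 1 - j) n`. -/
theorem tendsto_runProb_lowCount (hj : j + 1 < d) {c : ℝ} (hc : 0 < c) :
    Tendsto (fun n : ℕ => runProb d n (edgesAt d n (c * Real.log n ^ (d - 1 - j)))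
      (fun h => lowCount j h = 0)) atTop
      (𝓝 (Real.exp (-(2 * c * (d - 1).factorial / j.factorial)))) := by
  have hf : (0 : ℝ) < (d - 1).factorial := by positivity
  have hcont : Continuous fun κ : ℝ => Real.exp (-(κ / j.factorial)) := by fun_prop
  have hk0 : 0 < 2 * c * (d - 1).factorial := by positivity
  rw [tendsto_order]
  constructor
  · intro y hy
    -- A slightly larger `κ` means an earlier critical time, which the clock has passed with high
    -- probability, as the lower bound requires.
    have hev : ∀ᶠ κ in 𝓝[>] (2 * c * (d - 1).factorial), y < Real.exp (-(κ / j.factorial)) :=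
      (hcont.tendsto _).eventually (lt_mem_nhds hy) |>.filter_mono nhdsWithin_le_nhds
    obtain ⟨κ, hκ1, hκ2⟩ := (hev.and self_mem_nhdsWithin).exists
    have hκ : 0 < κ := hk0.trans hκ2
    have hκ3 : 2 * c < κ / (d - 1).factorial := by rwa [lt_div_iff₀ hf]
    have hm := (tendsto_missing (d := d) (p := d - 1 - j) (by omega) (by omega) hc).const_div_atTop
      (2 * (d : ℝ))
    have h1 := (((tendsto_one_sub_poi_pow (j := j) hκ).sub (tendsto_low_bound hj hc hκ)).sub hm).sub
      (tendsto_runProb_clock_le hj hc hκ hκ3)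
    rw [sub_zero, sub_zero, sub_zero] at h1
    filter_upwards [h1.eventually (lt_mem_nhds hκ1), eventually_critTime_nonneg j κ,
      eventually_edgesAt_le (d := d) (p := d - 1 - j) (by omega) (by omega) hc] with n h2 ha hT
    have h3 := le_runProb_lowCount (m := j) (by omega) hT ha
    rw [missing] at h2
    linarith
  · intro y hy
    -- A slightly smaller `κ` means a later critical time, which the clock has not passed with high
    -- probability, as the upper bound requires.
    have hev : ∀ᶠ κ in 𝓝[<] (2 * c * (d - 1).factorial), Real.exp (-(κ / j.factorial)) < y :=
      (hcont.tendsto _).eventually (gt_mem_nhds hy) |>.filter_mono nhdsWithin_le_nhds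
    obtain ⟨κ, ⟨hκ1, hκ2⟩, hκ⟩ := ((hev.and self_mem_nhdsWithin).and
      (nhdsWithin_le_nhds (lt_mem_nhds hk0))).exists
    have hκ3 : κ / (d - 1).factorial < 2 * c := by rwa [div_lt_iff₀ hf]
    have h1 := ((tendsto_one_sub_poi_pow (j := j) hκ).add (tendsto_low_bound hj hc hκ)).add
      (tendsto_runProb_lt_clock hj hc hκ hκ3)
    rw [add_zero, add_zero] at h1
    filter_upwards [h1.eventually (gt_mem_nhds hκ1), eventually_critTime_nonneg j κ,
      eventually_edgesAt_le (d := d) (p := d - 1 - j) (by omega) (by omega) hc] with n h2 ha hT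
    exact (runProb_lowCount_le (m := j) (by omega) hT ha).trans_lt h2

theorem exp_factorial_eq (hj : j + 1 < d) (c : ℝ) :
    2 * c * (d - 1).factorial / j.factorial =
      2 * ((d - 1).descFactorial (d - 1 - j) : ℝ) * c := by
  have h := Nat.factorial_mul_descFactorial (n := d - 1) (k := d - 1 - j) (by omega)
  rw [show d - 1 - (d - 1 - j) = j by omega] at h
  have hf : (0 : ℝ) < j.factorial := by positivity
  rw [← h]
  push_cast
  field_simp

theorem tendsto_dProb_log_pow (hj : j + 1 < d) {c : ℝ} (hc : 0 < c) :
    Tendsto (fun n : ℕ => dProb d n {h | (lastTime j h : ℝ) < ((d * n / 2 : ℕ) : ℝ) -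
      c * Real.log n ^ (d - 1 - j)}) atTop
      (𝓝 (Real.exp (-(2 * ((d - 1).descFactorial (d - 1 - j) : ℝ) * c)))) := by
  rw [← exp_factorial_eq hj]
  refine (tendsto_runProb_lowCount hj hc).congr' ?_
  filter_upwards [eventually_log_pos, eventually_gt_atTop 0,
    eventually_edgesAt_le (d := d) (p := d - 1 - j) (by omega) (by omega) hc] with n hL hn hT
  exact (dProb_lastTime_lt hn (mul_nonneg hc.le (pow_pos hL _).le) hT).symm

end

/-! ### Uniformity in `t` -/

section
open Classical

theorem runMean_mono_of_forall {d n : ℕ} (k : ℕ) : ∀ {f g : EdgeHistory n → ℝ},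
    (∀ h, f h ≤ g h) → runMean d n k f ≤ runMean d n k g := by
  induction k with
  | zero => intro f g hfg; exact hfg []
  | succ k ih =>
    intro f g hfg
    exact ih fun h => stepMean_mono (fun e _ => hfg _) (hfg h)

theorem dProb_mono {d n : ℕ} {A B : Set (EdgeHistory n)} (hAB : A ⊆ B) :
    dProb d n A ≤ dProb d n B := by
  rw [dProb_eq_runMean, dProb_eq_runMean]
  exact runMean_mono_of_forall _ fun h =>
    Set.indicator_le_indicator_of_subset hAB (fun _ => zero_le_one) h

theorem dProb_nonneg {d n : ℕ} (A : Set (EdgeHistory n)) : 0 ≤ dProb d n A :=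
  ENNReal.toReal_nonneg

theorem dProb_le_one {d n : ℕ} (A : Set (EdgeHistory n)) : dProb d n A ≤ 1 := by
  rw [dProb_eq_runMean, ← runMean_const (d := d) (n := n) (d * n / 2) 1]
  exact runMean_mono_of_forall _ fun h =>
    Set.indicator_apply_le' (fun _ => le_rfl) fun _ => zero_le_one

theorem dProb_le_add {d n : ℕ} {A B C : Set (EdgeHistory n)} (h : A ⊆ B ∪ C) :
    dProb d n A ≤ dProb d n B + dProb d n C := by
  rw [dProb_eq_runMean, dProb_eq_runMean, dProb_eq_runMean, ← runMean_add]
  refine runMean_mono_of_forall _ fun x => ?_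
  by_cases hA : x ∈ A
  · rw [Set.indicator_of_mem hA]
    rcases h hA with hx | hx
    · rw [Set.indicator_of_mem hx]
      exact le_add_of_nonneg_right (Set.indicator_nonneg (fun _ _ => zero_le_one) _)
    · rw [Set.indicator_of_mem hx]
      exact le_add_of_nonneg_left (Set.indicator_nonneg (fun _ _ => zero_le_one) _)
  · rw [Set.indicator_of_notMem hA]
    exact add_nonneg (Set.indicator_nonneg (fun _ _ => zero_le_one) _)
      (Set.indicator_nonneg (fun _ _ => zero_le_one) _)

/-- Antitone functions that converge pointwise to `exp (-β c)` converge uniformly. -/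
theorem tendsto_sub_exp_of_antitone {β : ℝ} (hβ : 0 < β) {G : ℕ → ℝ → ℝ}
    (hG0 : ∀ n c, 0 ≤ G n c) (hG1 : ∀ n c, G n c ≤ 1) (hanti : ∀ᶠ n in atTop, Antitone (G n))
    (hlim : ∀ c, 0 < c → Tendsto (fun n => G n c) atTop (𝓝 (Real.exp (-(β * c)))))
    {c : ℕ → ℝ} (hc : ∀ᶠ n in atTop, 0 < c n) :
    Tendsto (fun n => G n (c n) - Real.exp (-(β * c n))) atTop (𝓝 0) := by
  -- Along an ultrafilter `exp (-β * c n)` converges to some `x` in `[0, 1]`, even if `c n` tends to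
  -- zero or infinity. It remains to show that `G n (c n)` has the same limit.
  rw [tendsto_iff_ultrafilter]
  intro U hU
  obtain ⟨x, hx, hUx⟩ := (isCompact_Icc (a := (0 : ℝ)) (b := 1)).ultrafilter_le_nhds
    (U.map fun n => Real.exp (-(β * c n))) (by
      rw [le_principal_iff, Ultrafilter.mem_coe, Ultrafilter.mem_map]
      refine hU ?_
      filter_upwards [hc] with n hn
      exact ⟨(Real.exp_pos _).le, Real.exp_le_one_iff.2 (by nlinarith)⟩)
  have hUx' : Tendsto (fun n => Real.exp (-(β * c n))) U (𝓝 x) := hUx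
  have hexp : ∀ y, 0 < y → Real.exp (-(β * (-Real.log y / β))) = y := by
    intro y hy
    rw [mul_div_cancel₀ _ hβ.ne', neg_neg, Real.exp_log hy]
  have hcpos : ∀ y, 0 < y → y < 1 → 0 < -Real.log y / β := fun y h0 h1 =>
    div_pos (neg_pos.2 (Real.log_neg h0 h1)) hβ
  have hmain : Tendsto (fun n => G n (c n)) U (𝓝 x) := by
    rw [tendsto_order]
    constructor
    · intro z hz
      rcases lt_or_ge z 0 with hz0 | hz0
      · exact Eventually.of_forall fun n => hz0.trans_le (hG0 n _)
      -- As `0 < y < 1`, the limit law takes the value `y` at the positive point `-log y / β`.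
      -- Eventually `c n` lies to its left, and monotonicity compares the two values of `G n`.
      · obtain ⟨y, hy1, hy2⟩ := exists_between hz
        have hy0 : 0 < y := hz0.trans_lt hy1
        have h1 := (hlim _ (hcpos y hy0 (hy2.trans_le hx.2))).mono_left hU
        rw [hexp y hy0] at h1
        filter_upwards [h1.eventually (lt_mem_nhds hy1), hUx'.eventually (lt_mem_nhds hy2),
          hU hanti] with n h2 h3 h4
        refine h2.trans_le (h4 ?_)
        rw [le_div_iff₀ hβ]
        have h5 : Real.log y < -(β * c n) := (Real.log_lt_iff_lt_exp hy0).2 h3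
        linarith
    · intro z hz
      rcases lt_or_ge 1 z with hz1 | hz1
      · exact Eventually.of_forall fun n => (hG1 n _).trans_lt hz1
      · obtain ⟨y, hy1, hy2⟩ := exists_between hz
        have hy0 : 0 < y := hx.1.trans_lt hy1
        have h1 := (hlim _ (hcpos y hy0 (hy2.trans_le hz1))).mono_left hU
        rw [hexp y hy0] at h1
        filter_upwards [h1.eventually (gt_mem_nhds hy2), hUx'.eventually (gt_mem_nhds hy1),
          hU hanti] with n h2 h3 h4
        refine (h4 ?_).trans_lt h2
        rw [div_le_iff₀ hβ]
        have h5 : -(β * c n) < Real.log y := (Real.lt_log_iff_exp_lt hy0).2 h3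
        linarith
  have := hmain.sub hUx'
  rwa [sub_self] at this

end

/-! ### The two assertions of the theorem -/

theorem corollary1p8 (d j : ℕ) (hj : j + 1 < d) :
    (∀ t : ℕ → ℝ, (∀ n, 0 < t n) →
      Tendsto
        (fun n : ℕ =>
          dProb d n {h | (lastTime j h : ℝ) < ((d * n / 2 : ℕ) : ℝ) - t n}
            - Real.exp (-fRate j d (t n) n))
        atTop (𝓝 0)) ∧
    (∀ ε : ℝ, 0 < ε → ∃ c C : ℝ, 0 < c ∧ c ≤ C ∧
      ∀ᶠ n : ℕ in atTop,
        1 - ε ≤ dProb d n {h |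
          c * Real.log n ^ (d - 1 - j) ≤ ((d * n / 2 : ℕ) : ℝ) - (lastTime j h : ℝ) ∧
          ((d * n / 2 : ℕ) : ℝ) - (lastTime j h : ℝ) ≤ C * Real.log n ^ (d - 1 - j)}) := by
  have hβ : 0 < 2 * ((d - 1).descFactorial (d - 1 - j) : ℝ) := by
    have : 0 < (d - 1).descFactorial (d - 1 - j) := Nat.descFactorial_pos.2 (by omega)
    positivity
  constructor
  · intro t ht
    -- The variable is `t` in units of `log ^ (d-1-j) n`; in these units the limit no longer depends
    -- on `n`.
    have key := tendsto_sub_exp_of_antitone hβ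
      (G := fun n c => dProb d n {h | (lastTime j h : ℝ) < ((d * n / 2 : ℕ) : ℝ) -
        c * Real.log n ^ (d - 1 - j)}) (c := fun n => t n / Real.log n ^ (d - 1 - j))
      (fun n c => dProb_nonneg _) (fun n c => dProb_le_one _) ?_
      (fun c hc => tendsto_dProb_log_pow hj hc) ?_
    · refine key.congr' ?_
      filter_upwards [eventually_log_pos] with n hn
      have hL := (pow_pos hn (d - 1 - j)).ne'
      simp only [fRate, div_mul_cancel₀ _ hL, mul_div_assoc]
    · filter_upwards [eventually_log_pos] with n hn
      intro c c' hcc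
      refine dProb_mono fun h hh => ?_
      rw [Set.mem_ofPred_eq] at hh ⊢
      refine hh.trans_le ?_
      have := pow_pos hn (d - 1 - j)
      gcongr
    · filter_upwards [eventually_log_pos] with n hn
      exact div_pos (ht n) (pow_pos hn _)
  · intro ε hε
    set β := 2 * ((d - 1).descFactorial (d - 1 - j) : ℝ)
    have hsmall : Tendsto (fun c : ℝ => Real.exp (-(β * c))) (𝓝[>] 0) (𝓝 1) := by
      have h1 : Continuous fun c : ℝ => Real.exp (-(β * c)) := by fun_prop
      simpa using (h1.tendsto 0).mono_left nhdsWithin_le_nhds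
    have hlarge : Tendsto (fun c : ℝ => Real.exp (-(β * c))) atTop (𝓝 0) :=
      Real.tendsto_exp_neg_atTop_nhds_zero.comp (tendsto_id.const_mul_atTop hβ)
    -- The limit law at `c` is above `1 - ε / 2` and at `C` below `ε / 2`; the probability of the
    -- window between them is at least the difference.
    obtain ⟨c, hc1, hc0⟩ := ((hsmall.eventually
      (lt_mem_nhds (by linarith : 1 - ε / 2 < 1))).and self_mem_nhdsWithin).exists
    obtain ⟨C, hC1, hC2⟩ := ((hlarge.eventually
      (gt_mem_nhds (by linarith : 0 < ε / 2))).and (eventually_ge_atTop c)).exists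
    have hc0' : 0 < c := hc0
    refine ⟨c, C, hc0', hC2, ?_⟩
    filter_upwards [(tendsto_dProb_log_pow hj hc0').eventually (lt_mem_nhds hc1),
      (tendsto_dProb_log_pow hj (hc0'.trans_le hC2)).eventually (gt_mem_nhds hC1)] with n h1 h2
    have h3 := dProb_le_add (d := d) (n := n)
      (A := {h | (lastTime j h : ℝ) < ((d * n / 2 : ℕ) : ℝ) - c * Real.log n ^ (d - 1 - j)})
      (B := {h | c * Real.log n ^ (d - 1 - j) ≤ ((d * n / 2 : ℕ) : ℝ) - (lastTime j h : ℝ) ∧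
          ((d * n / 2 : ℕ) : ℝ) - (lastTime j h : ℝ) ≤ C * Real.log n ^ (d - 1 - j)})
      (C := {h | (lastTime j h : ℝ) < ((d * n / 2 : ℕ) : ℝ) - C * Real.log n ^ (d - 1 - j)})
      (fun h hh => by
        rw [Set.mem_ofPred_eq] at hh
        by_cases hC : (lastTime j h : ℝ) < ((d * n / 2 : ℕ) : ℝ) - C * Real.log n ^ (d - 1 - j)
        · exact Or.inr hC
        · exact Or.inl ⟨by linarith, by linarith⟩)
    linarith
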